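/- Write $\varphi$ for Euler's totient function. For an integer $q\ge 1$ and a real number $X$, let $R(X,q)$ be the number of residue classes modulo $q$ that contain a prime $p<X$, and let $R^*(X,q)$ be the number of those among them that are coprime to $q$ (so that $R^*(X,q)\le\varphi(q)$). 1. For every $\lambda>0$ there are a constant $c>0$ and an integer $q_0$, depending only on $\lambda$, such that $R^*(X,q)\ge c\,\varphi(q)$ for all integers $q\ge q_0$ and all real $X\ge\lambda\,\varphi(q)\log q$, and such that $R(X,q)\ge c\,\varphi(q)$ for all integers $q\ge 1$ and all real $X>2$ with $X\ge\lambda\,\varphi(q)\log q$. 2. Conversely, for every $c>0$ there is a constant $c'>0$, depending only on $c$, such that for all integers $q\ge 1$ and all real $X$, if $R(X,q)\ge c\,\varphi(q)$, then $X\ge c'\,\varphi(q)\log q$. -/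

import Mathlib

/-- The residue classes modulo `q` that contain a prime smaller than `X`. -/
def primeClasses (q : ℕ) (X : ℝ) : Set (ZMod q) :=
  {a | ∃ p : ℕ, p.Prime ∧ (p : ℝ) < X ∧ (p : ZMod q) = a}

/-- The reduced residue classes modulo `q` that contain a prime smaller than `X`. -/
def reducedPrimeClasses (q : ℕ) (X : ℝ) : Set (ZMod q) :=
  {a | a ∈ primeClasses q X ∧ IsUnit a}

/-! ### An upper bound sieve from local mean-zero functions. -/

section Sieve

open Finset

/-! The lower bound is a second moment argument. Let Y = λ φ(q) log q and let s count the primes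
below Y that are coprime to q. By Cauchy–Schwarz, s² ≤ R* · #{(p, p') : p ≡ p' mod q}
(`card_sq_le_card_image_mul`). Chebyshev gives s ≫ φ(q), so it suffices that the pairs with p ≠ p'
number O(φ(q)).

Such a pair is (p, p + kq) up to order. A Selberg-type sieve (`exists_card_prime_pairs_le`) bounds
the pairs for each k by O((kq/φ(kq)) Y/log² Y). Since k/φ(k) is bounded on average
(`exists_sum_div_totient_le`), summing over k ≤ Y/q gives O(Y²/(φ(q) log² Y)) = O(φ(q)).

The converse is Chebyshev's upper bound: distinct classes need distinct primes, so c φ(q) ≤ π(X) up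
to rounding X. If X is below about q^(1/4), this contradicts φ(q) ≫ √q unless q is bounded in terms
of c. -/

theorem sum_range_mul_of_periodic {a b : ℕ} (hab : a.Coprime b) (ha : 0 < a) (hb : 0 < b)
    {u v : ℕ → ℝ} (hu : Function.Periodic u a) (hv : Function.Periodic v b) :
    ∑ n ∈ range (a * b), u n * v n = (∑ n ∈ range a, u n) * ∑ n ∈ range b, v n := by
  rw [sum_mul_sum, ← sum_product']
  refine sum_nbij (fun n => (n % a, n % b)) ?_ ?_ ?_ ?_
  · intro n _
    simp [Nat.mod_lt _ ha, Nat.mod_lt _ hb]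
  · intro m hm n hn hmn
    simp only [coe_range, Set.mem_Iio] at hm hn
    simp only [Prod.mk.injEq] at hmn
    have h : m ≡ n [MOD a * b] := (Nat.modEq_and_modEq_iff_modEq_mul hab).1 hmn
    exact Nat.ModEq.eq_of_lt_of_lt h hm hn
  · rintro ⟨x, y⟩ hxy
    simp only [coe_product, coe_range, Set.mem_prod, Set.mem_Iio] at hxy
    refine ⟨Nat.chineseRemainder hab x y, ?_, ?_⟩
    · simpa using Nat.chineseRemainder_lt_mul hab x y ha.ne' hb.ne'
    · have h := (Nat.chineseRemainder hab x y).2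
      simp only [Nat.ModEq] at h
      simp [h.1, h.2, Nat.mod_eq_of_lt hxy.1, Nat.mod_eq_of_lt hxy.2]
  · intro n _
    simp [hu.map_mod_nat, hv.map_mod_nat]

theorem periodic_prod {S : Finset ℕ} {g : ℕ → ℕ → ℝ} (hg : ∀ p ∈ S, Function.Periodic (g p) p) :
    Function.Periodic (fun n => ∏ p ∈ S, g p n) (∏ p ∈ S, p) := by
  intro n
  refine prod_congr rfl fun p hp => ?_
  obtain ⟨k, hk⟩ := dvd_prod_of_mem (fun p : ℕ => p) hp
  rw [hk, mul_comm]
  exact (hg p hp).nat_mul k n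

theorem sum_range_prod_of_periodic {S : Finset ℕ} (hS : ∀ p ∈ S, p.Prime) {g : ℕ → ℕ → ℝ}
    (hg : ∀ p ∈ S, Function.Periodic (g p) p) :
    ∑ n ∈ range (∏ p ∈ S, p), ∏ p ∈ S, g p n = ∏ p ∈ S, ∑ n ∈ range p, g p n := by
  induction S using Finset.induction_on with
  | empty => simp
  | insert q S hq ih =>
    have hS' : ∀ p ∈ S, p.Prime := fun p hp => hS p (mem_insert_of_mem hp)
    have hg' : ∀ p ∈ S, Function.Periodic (g p) p := fun p hp => hg p (mem_insert_of_mem hp)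
    have hqp : q.Prime := hS q (mem_insert_self q S)
    rw [prod_insert hq, prod_insert hq, ← ih hS' hg']
    simp_rw [prod_insert hq]
    refine sum_range_mul_of_periodic ?_ hqp.pos (prod_pos fun p hp => (hS' p hp).pos)
      (hg q (mem_insert_self q S)) (periodic_prod hg')
    refine Nat.Coprime.prod_right fun p hp => (Nat.coprime_primes hqp (hS' p hp)).2 ?_
    rintro rfl
    exact hq hp

theorem sum_range_mul_period {N : ℕ} {u : ℕ → ℝ} (hu : Function.Periodic u N) (m : ℕ) :
    ∑ n ∈ range (N * m), u n = m * ∑ n ∈ range N, u n := by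
  induction m with
  | zero => simp
  | succ m ih =>
    rw [Nat.mul_succ, sum_range_add, ih]
    have h : ∀ x, u (N * m + x) = u x := fun x => by
      rw [add_comm, mul_comm]; exact hu.nat_mul m x
    simp only [h]
    push_cast
    ring

/-- Complete periods give the main term and fewer than N leftover terms give the error.
Nonnegativity of the period sum allows ⌊X/N⌋ to be replaced by X/N. -/
theorem sum_range_le_of_periodic {N X : ℕ} (hN : 0 < N) {u : ℕ → ℝ}
    (hu : Function.Periodic u N) {B : ℝ} (hB : ∀ n, |u n| ≤ B)
    (hS : 0 ≤ ∑ n ∈ range N, u n) :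
    ∑ n ∈ range X, u n ≤ X / N * ∑ n ∈ range N, u n + N * B := by
  have hB0 : 0 ≤ B := (abs_nonneg _).trans (hB 0)
  have hN' : (0 : ℝ) < N := by exact_mod_cast hN
  conv_lhs => rw [← Nat.div_add_mod X N]
  rw [sum_range_add, sum_range_mul_period hu]
  refine add_le_add (mul_le_mul_of_nonneg_right Nat.cast_div_le hS) ?_
  calc ∑ x ∈ range (X % N), u (N * (X / N) + x) ≤ ∑ x ∈ range (X % N), B :=
        sum_le_sum fun x _ => (le_abs_self _).trans (hB _)
    _ = (X % N : ℕ) * B := by simp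
    _ ≤ N * B := by
        gcongr
        exact (Nat.mod_lt _ hN).le

section

variable {P : Finset ℕ} {a : ℕ → ℕ → ℝ} {h : ℕ → ℝ}

/-- Orthogonality through the Chinese remainder theorem: if d ≠ e, some prime divides exactly one of
them and its local mean is zero; if d = e, each local sum is p · h p. The period is lcm(d, e) ≤ z²
and the terms are at most z², whence the error z⁴. -/
theorem sum_range_local_mul_local_le (hP : ∀ p ∈ P, p.Prime)
    (hper : ∀ p ∈ P, Function.Periodic (a p) p) (hbd : ∀ p ∈ P, ∀ n, |a p n| ≤ p)
    (hmean : ∀ p ∈ P, ∑ n ∈ range p, a p n = 0)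
    (hsq : ∀ p ∈ P, ∑ n ∈ range p, a p n * a p n = p * h p) (h0 : ∀ p ∈ P, 0 ≤ h p)
    {z : ℕ} {d e : ℕ} (hd : Squarefree d) (he : Squarefree e) (hdz : d ≤ z) (hez : e ≤ z)
    (hdP : d.primeFactors ⊆ P) (heP : e.primeFactors ⊆ P) (X : ℕ) :
    ∑ n ∈ range X, (∏ p ∈ d.primeFactors, a p n) * ∏ p ∈ e.primeFactors, a p n ≤
      (if d = e then X * ∏ p ∈ d.primeFactors, h p else 0) + (z : ℝ) ^ 4 := by
  set S := d.primeFactors ∪ e.primeFactors with hSdef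
  have hSP : S ⊆ P := union_subset hdP heP
  set g : ℕ → ℕ → ℝ := fun p n =>
    (if p ∈ d.primeFactors then a p n else 1) * (if p ∈ e.primeFactors then a p n else 1) with hg
  have hgper : ∀ p ∈ S, Function.Periodic (g p) p := by
    intro p hp n
    simp only [hg, hper p (hSP hp) n]
  have hprod : ∀ n, (∏ p ∈ d.primeFactors, a p n) * ∏ p ∈ e.primeFactors, a p n
      = ∏ p ∈ S, g p n := by
    intro n
    simp only [hg, prod_mul_distrib]
    congr 1
    · rw [← prod_filter, hSdef]
      congr 1
      ext p; simp only [mem_filter, mem_union]; tauto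
    · rw [← prod_filter, hSdef]
      congr 1
      ext p; simp only [mem_filter, mem_union]; tauto
  have hsum := sum_range_prod_of_periodic (fun p hp => hP p (hSP hp)) hgper
  have hNpos : 0 < ∏ p ∈ S, p := prod_pos fun p hp => (hP p (hSP hp)).pos
  have hNle : ∏ p ∈ S, p ≤ z ^ 2 := by
    calc ∏ p ∈ S, p ≤ (∏ p ∈ S, p) * ∏ p ∈ d.primeFactors ∩ e.primeFactors, p :=
          Nat.le_mul_of_pos_right _ (prod_pos fun p hp =>
            (hP p (hdP (mem_inter.1 hp).1)).pos)
      _ = d * e := by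
          rw [prod_union_inter, Nat.prod_primeFactors_of_squarefree hd,
            Nat.prod_primeFactors_of_squarefree he]
      _ ≤ z ^ 2 := by rw [sq]; exact Nat.mul_le_mul hdz hez
  have hloc : ∀ c, Squarefree c → c ≤ z → c.primeFactors ⊆ P → ∀ n,
      |∏ p ∈ c.primeFactors, a p n| ≤ z := by
    intro c hc hcz hcP n
    rw [abs_prod]
    calc ∏ p ∈ c.primeFactors, |a p n| ≤ ∏ p ∈ c.primeFactors, (p : ℝ) :=
          prod_le_prod (fun _ _ => abs_nonneg _) fun p hp => hbd p (hcP hp) n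
      _ = c := by rw [← Nat.cast_prod, Nat.prod_primeFactors_of_squarefree hc]
      _ ≤ z := by exact_mod_cast hcz
  have hbound : ∀ n, |∏ p ∈ S, g p n| ≤ (z : ℝ) ^ 2 := by
    intro n
    rw [← hprod, abs_mul, sq]
    exact mul_le_mul (hloc d hd hdz hdP n) (hloc e he hez heP n) (abs_nonneg _) (by positivity)
  have hperiod : ∏ p ∈ S, ∑ n ∈ range p, g p n =
      if d = e then (∏ p ∈ S, (p : ℝ)) * ∏ p ∈ d.primeFactors, h p else 0 := by
    split_ifs with hde
    · subst hde
      rw [hSdef, union_self, ← prod_mul_distrib]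
      refine prod_congr rfl fun p hp => ?_
      simp only [hg, if_pos hp]
      exact hsq p (hdP hp)
    · have hne : d.primeFactors ≠ e.primeFactors := by
        intro heq
        apply hde
        rw [← Nat.prod_primeFactors_of_squarefree hd, heq,
          Nat.prod_primeFactors_of_squarefree he]
      obtain ⟨p, hp⟩ : ∃ p, ¬(p ∈ d.primeFactors ↔ p ∈ e.primeFactors) := by
        by_contra! hcon
        exact hne (Finset.ext hcon)
      have hpS : p ∈ S := by rw [hSdef, mem_union]; tauto
      refine prod_eq_zero hpS ?_
      rw [← hmean p (hSP hpS)]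
      refine sum_congr rfl fun n _ => ?_
      by_cases h1 : p ∈ d.primeFactors
      · have h2 : p ∉ e.primeFactors := by tauto
        simp only [hg, if_pos h1, if_neg h2, mul_one]
      · have h2 : p ∈ e.primeFactors := by tauto
        simp only [hg, if_neg h1, if_pos h2, one_mul]
  have hN' : (0 : ℝ) < (∏ p ∈ S, p : ℕ) := by exact_mod_cast hNpos
  have key := sum_range_le_of_periodic (X := X) hNpos (periodic_prod hgper) hbound (by
    rw [hsum, hperiod]
    split_ifs
    · exact mul_nonneg (prod_nonneg fun _ _ => by positivity)
        (prod_nonneg fun p hp => h0 p (hdP hp))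
    · exact le_rfl)
  simp_rw [hprod]
  refine key.trans (add_le_add (le_of_eq ?_) ?_)
  · rw [hsum, hperiod]
    split_ifs
    · rw [← Nat.cast_prod]
      field_simp
    · simp
  · calc ((∏ p ∈ S, p : ℕ) : ℝ) * (z : ℝ) ^ 2 ≤ ((z ^ 2 : ℕ) : ℝ) * (z : ℝ) ^ 2 := by
          gcongr
      _ = (z : ℝ) ^ 4 := by push_cast; ring

/-- An upper bound sieve: if for each prime `p` the function `a p` has mean zero, mean square
`h p`, and takes the value `h p` on the sifted set, then the sifted set is small. -/
theorem card_sifted_mul_sq_le (hP : ∀ p ∈ P, p.Prime)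
    (hper : ∀ p ∈ P, Function.Periodic (a p) p) (hbd : ∀ p ∈ P, ∀ n, |a p n| ≤ p)
    (hmean : ∀ p ∈ P, ∑ n ∈ range p, a p n = 0)
    (hsq : ∀ p ∈ P, ∑ n ∈ range p, a p n * a p n = p * h p) (h0 : ∀ p ∈ P, 0 ≤ h p)
    {z : ℕ} {D : Finset ℕ} (hD : ∀ d ∈ D, Squarefree d ∧ d ≤ z ∧ d.primeFactors ⊆ P)
    {X : ℕ} {S : Finset ℕ} (hSX : S ⊆ range X) (hS : ∀ n ∈ S, ∀ p ∈ P, a p n = h p) :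
    (#S : ℝ) * (∑ d ∈ D, ∏ p ∈ d.primeFactors, h p) ^ 2 ≤
      X * (∑ d ∈ D, ∏ p ∈ d.primeFactors, h p) + (z : ℝ) ^ 6 := by
  set G := ∑ d ∈ D, ∏ p ∈ d.primeFactors, h p with hG
  have hcard : (#D : ℝ) ≤ z := by
    have : D ⊆ Icc 1 z := fun d hd =>
      mem_Icc.2 ⟨Nat.pos_of_ne_zero (hD d hd).1.ne_zero, (hD d hd).2.1⟩
    have := card_le_card this
    rw [Nat.card_Icc, Nat.add_sub_cancel] at this
    exact_mod_cast this
  -- On S the inner sum is the constant G; off S the square is only nonnegative. Expanding it leaves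
  -- the diagonal X · G and at most z² errors of size z⁴.
  calc (#S : ℝ) * G ^ 2 = ∑ n ∈ S, (∑ d ∈ D, ∏ p ∈ d.primeFactors, a p n) ^ 2 := by
        rw [sum_congr rfl (g := fun _ => G ^ 2), sum_const, nsmul_eq_mul]
        intro n hn
        rw [hG]
        congr 1
        exact sum_congr rfl fun d hd => prod_congr rfl fun p hp => hS n hn p ((hD d hd).2.2 hp)
    _ ≤ ∑ n ∈ range X, (∑ d ∈ D, ∏ p ∈ d.primeFactors, a p n) ^ 2 :=
        sum_le_sum_of_subset_of_nonneg hSX fun _ _ _ => sq_nonneg _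
    _ = ∑ d ∈ D, ∑ e ∈ D, ∑ n ∈ range X,
          (∏ p ∈ d.primeFactors, a p n) * ∏ p ∈ e.primeFactors, a p n := by
        simp_rw [sq, sum_mul_sum]
        rw [sum_comm]
        exact sum_congr rfl fun d _ => sum_comm
    _ ≤ ∑ d ∈ D, ∑ e ∈ D,
          ((if d = e then X * ∏ p ∈ d.primeFactors, h p else 0) + (z : ℝ) ^ 4) :=
        sum_le_sum fun d hd => sum_le_sum fun e he =>
          sum_range_local_mul_local_le hP hper hbd hmean hsq h0 (hD d hd).1 (hD e he).1
            (hD d hd).2.1 (hD e he).2.1 (hD d hd).2.2 (hD e he).2.2 X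
    _ = X * G + #D * (#D * (z : ℝ) ^ 4) := by
        simp only [sum_add_distrib, sum_const, nsmul_eq_mul, sum_ite_eq, hG, mul_sum]
        congr 1
        exact sum_congr rfl fun d hd => if_pos hd
    _ ≤ X * G + z * (z * (z : ℝ) ^ 4) := by gcongr
    _ = X * G + (z : ℝ) ^ 6 := by ring

end

end Sieve

/-! ### Lower bounds for the denominator of the sieve. -/

section ReciprocalSums

open Finset

theorem sum_le_sum_of_injOn' {α β : Type*} {A : Finset α} {B : Finset β} {f : α → ℝ} {g : β → ℝ}
    (φ : α → β) (hmaps : ∀ a ∈ A, φ a ∈ B) (hinj : Set.InjOn φ A)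
    (hfg : ∀ a ∈ A, f a ≤ g (φ a)) (hg : ∀ b ∈ B, 0 ≤ g b) : ∑ a ∈ A, f a ≤ ∑ b ∈ B, g b := by
  classical
  calc ∑ a ∈ A, f a ≤ ∑ a ∈ A, g (φ a) := sum_le_sum hfg
    _ = ∑ b ∈ A.image φ, g b := (sum_image hinj).symm
    _ ≤ ∑ b ∈ B, g b := sum_le_sum_of_subset_of_nonneg
        (image_subset_iff.2 hmaps) fun b hb _ => hg b hb

/-- Sifting by one more prime q loses at most the fraction 1/q: if qm survived the earlier primes,
so did m. -/
theorem prod_mul_sum_inv_le (y : ℕ) {S : Finset ℕ} (hS : ∀ p ∈ S, p.Prime) :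
    (∏ p ∈ S, (1 - (p : ℝ)⁻¹)) * ∑ n ∈ Icc 1 y, (n : ℝ)⁻¹ ≤
      ∑ n ∈ Icc 1 y with ∀ p ∈ S, ¬p ∣ n, (n : ℝ)⁻¹ := by
  induction S using Finset.induction_on with
  | empty => simp
  | insert q S hq ih =>
    have hqp : q.Prime := hS q (mem_insert_self q S)
    have hq0 : (0 : ℝ) < q := by exact_mod_cast hqp.pos
    have hq1 : (q : ℝ)⁻¹ ≤ 1 := inv_le_one_of_one_le₀ (by exact_mod_cast hqp.one_lt.le)
    set A := {n ∈ Icc 1 y | ∀ p ∈ S, ¬p ∣ n} with hA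
    have hsplit : ({n ∈ Icc 1 y | ∀ p ∈ insert q S, ¬p ∣ n} : Finset ℕ) = {n ∈ A | ¬q ∣ n} := by
      ext n
      simp only [hA, mem_filter, mem_insert, forall_eq_or_imp]
      tauto
    have hmul : ∑ n ∈ A with q ∣ n, (n : ℝ)⁻¹ ≤ ∑ n ∈ A, (q : ℝ)⁻¹ * (n : ℝ)⁻¹ := by
      refine sum_le_sum_of_injOn' (fun n => n / q) ?_ ?_ ?_ ?_
      · intro n hn
        obtain ⟨hn1, m, rfl⟩ := mem_filter.1 hn
        simp only [hA, mem_filter, mem_Icc] at hn1 ⊢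
        rw [Nat.mul_div_cancel_left _ hqp.pos]
        refine ⟨⟨Nat.pos_of_ne_zero ?_, (Nat.le_mul_of_pos_left m hqp.pos).trans hn1.1.2⟩,
          fun p hp hpm => hn1.2 p hp (hpm.mul_left q)⟩
        rintro rfl
        simp at hn1
      · intro m hm n hn hmn
        simp only [coe_filter, Set.mem_ofPred_eq] at hm hn
        rw [← Nat.div_mul_cancel hm.2, ← Nat.div_mul_cancel hn.2]
        exact congrArg (· * q) hmn
      · intro n hn
        obtain ⟨-, m, rfl⟩ := mem_filter.1 hn
        simp only [Nat.mul_div_cancel_left _ hqp.pos]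
        push_cast
        rw [mul_inv]
      · intro n _
        positivity
    have hadd := sum_filter_add_sum_filter_not A (fun n => q ∣ n) (fun n : ℕ => (n : ℝ)⁻¹)
    rw [← mul_sum] at hmul
    rw [prod_insert hq, mul_assoc, hsplit]
    calc (1 - (q : ℝ)⁻¹) * ((∏ p ∈ S, (1 - (p : ℝ)⁻¹)) * ∑ n ∈ Icc 1 y, (n : ℝ)⁻¹)
        ≤ (1 - (q : ℝ)⁻¹) * ∑ n ∈ A, (n : ℝ)⁻¹ :=
          mul_le_mul_of_nonneg_left (ih fun p hp => hS p (mem_insert_of_mem hp)) (by linarith)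
      _ ≤ ∑ n ∈ A with ¬q ∣ n, (n : ℝ)⁻¹ := by linarith

theorem totient_div_eq_prod (H : ℕ) (hH : H ≠ 0) :
    (H.totient : ℝ) / H = ∏ p ∈ H.primeFactors, (1 - (p : ℝ)⁻¹) := by
  have h := congrArg (Rat.cast : ℚ → ℝ) (Nat.totient_eq_mul_prod_factors H)
  push_cast at h
  rw [h, mul_div_cancel_left₀]
  exact_mod_cast hH

theorem log_mul_totient_div_le_sum_coprime (y : ℕ) {H : ℕ} (hH : H ≠ 0) :
    (H.totient : ℝ) / H * Real.log (y + 1) ≤ ∑ n ∈ Icc 1 y with n.Coprime H, (n : ℝ)⁻¹ := by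
  have hlog : Real.log (y + 1) ≤ ∑ n ∈ Icc 1 y, (n : ℝ)⁻¹ := by
    have h := log_add_one_le_harmonic y
    rw [harmonic_eq_sum_Icc] at h
    push_cast at h
    exact h
  have hset : ({n ∈ Icc 1 y | n.Coprime H} : Finset ℕ) =
      {n ∈ Icc 1 y | ∀ p ∈ H.primeFactors, ¬p ∣ n} := by
    refine filter_congr fun n _ => ⟨fun h p hp hpn => ?_, fun h => ?_⟩
    · exact (Nat.prime_of_mem_primeFactors hp).one_lt.ne'
        (Nat.eq_one_of_dvd_coprimes h hpn (Nat.dvd_of_mem_primeFactors hp))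
    · exact Nat.coprime_of_dvd fun p hp hpn hpH =>
        h p (Nat.mem_primeFactors.2 ⟨hp, hpH, hH⟩) hpn
  rw [hset]
  refine le_trans ?_ (prod_mul_sum_inv_le y fun p hp => Nat.prime_of_mem_primeFactors hp)
  rw [← totient_div_eq_prod H hH]
  exact mul_le_mul_of_nonneg_left hlog (by positivity)

theorem sum_inv_sq_le_tsum (A : Finset ℕ) :
    ∑ n ∈ A, ((n : ℝ) ^ 2)⁻¹ ≤ ∑' n : ℕ, ((n : ℝ) ^ 2)⁻¹ :=
  (Real.summable_nat_pow_inv.2 one_lt_two).sum_le_tsum A fun _ _ => by positivity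

/-- Write n = s²r with r squarefree; closure under divisors keeps s and r in A. -/
theorem sum_inv_le_sum_squarefree {A : Finset ℕ} (hA : ∀ n ∈ A, ∀ m, m ∣ n → m ∈ A) :
    ∑ n ∈ A, (n : ℝ)⁻¹ ≤
      (∑' n : ℕ, ((n : ℝ) ^ 2)⁻¹) * ∑ n ∈ A with Squarefree n, (n : ℝ)⁻¹ := by
  choose r s hrs hr using Nat.sq_mul_squarefree
  calc ∑ n ∈ A, (n : ℝ)⁻¹
      ≤ ∑ x ∈ A ×ˢ {n ∈ A | Squarefree n}, ((x.1 : ℝ) ^ 2)⁻¹ * (x.2 : ℝ)⁻¹ := by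
        refine sum_le_sum_of_injOn' (fun n => (s n, r n)) ?_ ?_ ?_ ?_
        · intro n hn
          simp only [mem_product, mem_filter]
          exact ⟨hA n hn _ ⟨s n * r n, by rw [← mul_assoc, ← sq, hrs]⟩,
            hA n hn _ ⟨s n ^ 2, by rw [mul_comm, hrs]⟩, hr n⟩
        · intro m _ n _ hmn
          simp only [Prod.mk.injEq] at hmn
          rw [← hrs m, ← hrs n, hmn.1, hmn.2]
        · intro n _
          rw [← mul_inv]
          refine le_of_eq ?_
          congr 1
          exact_mod_cast (hrs n).symm
        · intro x _
          positivity
    _ = (∑ n ∈ A, ((n : ℝ) ^ 2)⁻¹) * ∑ n ∈ A with Squarefree n, (n : ℝ)⁻¹ := by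
        rw [sum_mul_sum, sum_product]
    _ ≤ _ := mul_le_mul_of_nonneg_right (sum_inv_sq_le_tsum A)
        (sum_nonneg fun _ _ => by positivity)

/-- Dividing a pair by its gcd g leaves a coprime pair and a factor g⁻². -/
theorem sum_mul_sum_inv_le_sum_coprime {A B : Finset ℕ} (hA0 : 0 ∉ A)
    (hA : ∀ n ∈ A, ∀ m, m ∣ n → m ∈ A) (hB : ∀ n ∈ B, ∀ m, m ∣ n → m ∈ B) :
    (∑ n ∈ A, (n : ℝ)⁻¹) * ∑ n ∈ B, (n : ℝ)⁻¹ ≤ (∑' n : ℕ, ((n : ℝ) ^ 2)⁻¹) *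
      ∑ x ∈ A ×ˢ B with x.1.Coprime x.2, (x.1 : ℝ)⁻¹ * (x.2 : ℝ)⁻¹ := by
  rw [sum_mul_sum, ← sum_product']
  calc ∑ x ∈ A ×ˢ B, (x.1 : ℝ)⁻¹ * (x.2 : ℝ)⁻¹
      ≤ ∑ w ∈ A ×ˢ {x ∈ A ×ˢ B | x.1.Coprime x.2},
          ((w.1 : ℝ) ^ 2)⁻¹ * ((w.2.1 : ℝ)⁻¹ * (w.2.2 : ℝ)⁻¹) := by
        have hpos : ∀ x ∈ A ×ˢ B, 0 < x.1.gcd x.2 := fun x hx =>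
          Nat.gcd_pos_of_pos_left _ (Nat.pos_of_ne_zero fun h => hA0 (h ▸ (mem_product.1 hx).1))
        have h1 : ∀ x : ℕ × ℕ, x.1.gcd x.2 * (x.1 / x.1.gcd x.2) = x.1 := fun x =>
          Nat.mul_div_cancel' (Nat.gcd_dvd_left _ _)
        have h2 : ∀ x : ℕ × ℕ, x.1.gcd x.2 * (x.2 / x.1.gcd x.2) = x.2 := fun x =>
          Nat.mul_div_cancel' (Nat.gcd_dvd_right _ _)
        refine sum_le_sum_of_injOn'
          (fun x => (x.1.gcd x.2, x.1 / x.1.gcd x.2, x.2 / x.1.gcd x.2)) ?_ ?_ ?_ ?_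
        · intro x hx
          have hx' := mem_product.1 hx
          simp only [mem_product, mem_filter]
          exact ⟨hA _ hx'.1 _ (Nat.gcd_dvd_left _ _),
            ⟨hA _ hx'.1 _ (Nat.div_dvd_of_dvd (Nat.gcd_dvd_left _ _)),
              hB _ hx'.2 _ (Nat.div_dvd_of_dvd (Nat.gcd_dvd_right _ _))⟩,
            Nat.coprime_div_gcd_div_gcd (hpos x hx)⟩
        · intro x _ w _ hxw
          simp only [Prod.mk.injEq] at hxw
          refine Prod.ext ?_ ?_
          · rw [← h1 x, hxw.2.1, hxw.1, h1 w]
          · rw [← h2 x, hxw.2.2, hxw.1, h2 w]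
        · intro x _
          refine le_of_eq ?_
          simp only [← mul_inv]
          congr 1
          have key : ∀ g u v a b : ℕ, g * u = a → g * v = b → a * b = g ^ 2 * (u * v) := by
            rintro _ _ _ _ _ rfl rfl
            ring
          exact_mod_cast key _ _ _ _ _ (h1 x) (h2 x)
        · intro x _
          positivity
    _ = (∑ n ∈ A, ((n : ℝ) ^ 2)⁻¹) *
          ∑ x ∈ A ×ˢ B with x.1.Coprime x.2, (x.1 : ℝ)⁻¹ * (x.2 : ℝ)⁻¹ := by
        rw [sum_mul_sum, sum_product]
    _ ≤ _ := mul_le_mul_of_nonneg_right (sum_inv_sq_le_tsum A)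
        (sum_nonneg fun _ _ => by positivity)

/-- A factorization of d is determined by the primes of its second factor, which must avoid the
primes dividing H. -/
theorem card_coprime_factorizations_le {A B : Finset ℕ} {H : ℕ} (hB : ∀ b ∈ B, b.Coprime H)
    {d : ℕ} (hd : Squarefree d) :
    (#{x ∈ A ×ˢ B | x.1 * x.2 = d} : ℝ) ≤
      ∏ p ∈ d.primeFactors, (if p ∣ H then 1 else 2 : ℝ) := by
  have hcard : #{x ∈ A ×ˢ B | x.1 * x.2 = d} ≤
      #({p ∈ d.primeFactors | ¬p ∣ H}.powerset) := by
    refine card_le_card_of_injOn (fun x => x.2.primeFactors) ?_ ?_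
    · intro x hx
      simp only [coe_filter, Set.mem_ofPred_eq, mem_product] at hx
      simp only [coe_powerset, Set.mem_preimage, Set.mem_powerset_iff, coe_subset]
      intro p hp
      rw [mem_filter]
      refine ⟨Nat.primeFactors_mono ⟨x.1, by rw [mul_comm, hx.2]⟩ hd.ne_zero hp, fun hpH => ?_⟩
      exact (Nat.prime_of_mem_primeFactors hp).one_lt.ne' (Nat.eq_one_of_dvd_coprimes
        (hB _ hx.1.2) (Nat.dvd_of_mem_primeFactors hp) hpH)
    · intro x hx w hw hxw
      simp only [coe_filter, Set.mem_ofPred_eq] at hx hw hxw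
      have hx2 : Squarefree x.2 := hd.squarefree_of_dvd ⟨x.1, by rw [mul_comm, hx.2]⟩
      have hw2 : Squarefree w.2 := hd.squarefree_of_dvd ⟨w.1, by rw [mul_comm, hw.2]⟩
      have h2 : x.2 = w.2 := by
        rw [← Nat.prod_primeFactors_of_squarefree hx2, hxw,
          Nat.prod_primeFactors_of_squarefree hw2]
      refine Prod.ext (Nat.eq_of_mul_eq_mul_right (Nat.pos_of_ne_zero hx2.ne_zero) ?_) h2
      rw [hx.2, h2, hw.2]
  rw [card_powerset] at hcard
  calc (#{x ∈ A ×ˢ B | x.1 * x.2 = d} : ℝ) ≤ 2 ^ #{p ∈ d.primeFactors | ¬p ∣ H} := by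
        exact_mod_cast hcard
    _ = ∏ p ∈ d.primeFactors, (if p ∣ H then 1 else 2 : ℝ) := by
        rw [prod_ite, prod_const_one, one_mul, prod_const]

/-- The sum over odd squarefree `d ≤ y ^ 2` which is the denominator of the sieve bound for
pairs of primes with difference `H`. -/
theorem totient_div_mul_log_sq_le (y : ℕ) {H : ℕ} (hH : H ≠ 0) {h : ℕ → ℝ}
    (hh : ∀ p, p.Prime → Odd p → (if p ∣ H then 1 else 2 : ℝ) / p ≤ h p) :
    (H.totient : ℝ) / H * Real.log (y + 1) ^ 2 ≤ 4 * (∑' n : ℕ, ((n : ℝ) ^ 2)⁻¹) ^ 3 *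
      ∑ d ∈ Icc 1 (y ^ 2) with Squarefree d ∧ Odd d, ∏ p ∈ d.primeFactors, h p := by
  set Z := ∑' n : ℕ, ((n : ℝ) ^ 2)⁻¹ with hZ
  have hZ0 : 0 ≤ Z := tsum_nonneg fun _ => by positivity
  have hlog0 : 0 ≤ Real.log (y + 1) := Real.log_nonneg (by simp)
  have hclosed : ∀ M : ℕ, ∀ n ∈ ({n ∈ Icc 1 y | n.Coprime M} : Finset ℕ), ∀ m, m ∣ n →
      m ∈ ({n ∈ Icc 1 y | n.Coprime M} : Finset ℕ) := by
    intro M n hn m hmn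
    simp only [mem_filter, mem_Icc] at hn ⊢
    exact ⟨⟨Nat.pos_of_dvd_of_pos hmn hn.1.1, (Nat.le_of_dvd hn.1.1 hmn).trans hn.1.2⟩,
      hn.2.of_dvd_left hmn⟩
  -- Products ab of coprime a ∈ A, b ∈ B are odd, squarefree and at most y². A prime not dividing H
  -- may go to either factor, a prime dividing H only to a; this reproduces the local weights 2/p
  -- and 1/p. Two factors Z pay for squarefreeness and a third for coprimality.
  set A := {n ∈ ({n ∈ Icc 1 y | n.Coprime 2} : Finset ℕ) | Squarefree n} with hAdef
  set B := {n ∈ ({n ∈ Icc 1 y | n.Coprime (2 * H)} : Finset ℕ) | Squarefree n} with hBdef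
  have hA1 : 1 / 2 * Real.log (y + 1) ≤ Z * ∑ n ∈ A, (n : ℝ)⁻¹ := by
    refine le_trans ?_ (sum_inv_le_sum_squarefree (hclosed 2))
    simpa using log_mul_totient_div_le_sum_coprime y two_ne_zero
  have hB1 : (H.totient : ℝ) / (2 * H) * Real.log (y + 1) ≤ Z * ∑ n ∈ B, (n : ℝ)⁻¹ := by
    refine le_trans ?_ (sum_inv_le_sum_squarefree (hclosed (2 * H)))
    refine le_trans ?_ (log_mul_totient_div_le_sum_coprime y (H := 2 * H) (by simpa using hH))
    push_cast
    gcongr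
    exact Nat.le_of_dvd (Nat.totient_pos.2 (by omega))
      (Nat.totient_dvd_of_dvd (Dvd.intro_left 2 rfl))
  have hAB := sum_mul_sum_inv_le_sum_coprime (A := A) (B := B) (by simp [hAdef])
    (fun n hn m hmn => by
      rw [hAdef, mem_filter] at hn ⊢
      exact ⟨hclosed 2 n hn.1 m hmn, hn.2.squarefree_of_dvd hmn⟩)
    (fun n hn m hmn => by
      rw [hBdef, mem_filter] at hn ⊢
      exact ⟨hclosed (2 * H) n hn.1 m hmn, hn.2.squarefree_of_dvd hmn⟩)
  set D : Finset ℕ := {d ∈ Icc 1 (y ^ 2) | Squarefree d ∧ Odd d} with hD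
  have hfib : ∑ x ∈ A ×ˢ B with x.1.Coprime x.2, (x.1 : ℝ)⁻¹ * (x.2 : ℝ)⁻¹ ≤
      ∑ d ∈ D, ∏ p ∈ d.primeFactors, h p := by
    have hmaps : ∀ x ∈ ({x ∈ A ×ˢ B | x.1.Coprime x.2} : Finset (ℕ × ℕ)), x.1 * x.2 ∈ D := by
      intro x hx
      simp only [hAdef, hBdef, mem_filter, mem_product, mem_Icc] at hx
      obtain ⟨⟨⟨⟨⟨a1, a2⟩, a3⟩, a4⟩, ⟨⟨b1, b2⟩, b3⟩, b4⟩, hc⟩ := hx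
      simp only [hD, mem_filter, mem_Icc]
      refine ⟨⟨Nat.mul_pos a1 b1, by rw [sq]; exact Nat.mul_le_mul a2 b2⟩,
        (Nat.squarefree_mul hc).2 ⟨a4, b4⟩, ?_⟩
      exact (Nat.coprime_two_right.1 a3).mul
        (Nat.coprime_two_right.1 (b3.of_dvd_right (Dvd.intro H rfl)))
    rw [← sum_fiberwise_of_maps_to hmaps]
    refine sum_le_sum fun d hd => ?_
    obtain ⟨-, hdsq, hdodd⟩ := mem_filter.1 hd
    calc ∑ x ∈ {x ∈ A ×ˢ B | x.1.Coprime x.2} with x.1 * x.2 = d, (x.1 : ℝ)⁻¹ * (x.2 : ℝ)⁻¹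
        ≤ ∑ x ∈ A ×ˢ B with x.1 * x.2 = d, (x.1 : ℝ)⁻¹ * (x.2 : ℝ)⁻¹ :=
          sum_le_sum_of_subset_of_nonneg
            (filter_subset_filter _ (filter_subset _ _)) fun _ _ _ => by positivity
      _ = #{x ∈ A ×ˢ B | x.1 * x.2 = d} * (d : ℝ)⁻¹ := by
          rw [← nsmul_eq_mul, ← sum_const]
          refine sum_congr rfl fun x hx => ?_
          rw [← (mem_filter.1 hx).2]
          push_cast
          rw [mul_inv]
      _ ≤ (∏ p ∈ d.primeFactors, (if p ∣ H then 1 else 2 : ℝ)) * (d : ℝ)⁻¹ := by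
          refine mul_le_mul_of_nonneg_right (card_coprime_factorizations_le ?_ hdsq)
            (by positivity)
          intro b hb
          simp only [hBdef, mem_filter] at hb
          exact hb.1.2.of_dvd_right (Dvd.intro_left 2 rfl)
      _ = ∏ p ∈ d.primeFactors, (if p ∣ H then 1 else 2 : ℝ) / p := by
          rw [prod_div_distrib, ← Nat.cast_prod, Nat.prod_primeFactors_of_squarefree hdsq,
            div_eq_mul_inv]
      _ ≤ ∏ p ∈ d.primeFactors, h p :=
          prod_le_prod (fun p _ => by split_ifs <;> positivity) fun p hp =>
            hh p (Nat.prime_of_mem_primeFactors hp)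
              (hdodd.of_dvd_nat (Nat.dvd_of_mem_primeFactors hp))
  calc (H.totient : ℝ) / H * Real.log (y + 1) ^ 2
      = 4 * ((1 / 2 * Real.log (y + 1)) * ((H.totient : ℝ) / (2 * H) * Real.log (y + 1))) := by
        field_simp; ring
    _ ≤ 4 * ((Z * ∑ n ∈ A, (n : ℝ)⁻¹) * (Z * ∑ n ∈ B, (n : ℝ)⁻¹)) := by
        gcongr
    _ = 4 * Z ^ 2 * ((∑ n ∈ A, (n : ℝ)⁻¹) * ∑ n ∈ B, (n : ℝ)⁻¹) := by ring
    _ ≤ 4 * Z ^ 2 * (Z * ∑ d ∈ D, ∏ p ∈ d.primeFactors, h p) := by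
        exact mul_le_mul_of_nonneg_left (hAB.trans (mul_le_mul_of_nonneg_left hfib hZ0))
          (by positivity)
    _ = _ := by ring

end ReciprocalSums

/-! ### The sieve bound for prime pairs with a fixed difference. -/

section PrimePairs

open Finset

/-- The number of residues excluded modulo `p` when sieving for `n` and `n + H` both prime. -/
def excludedCount (H p : ℕ) : ℕ := #{n ∈ range p | p ∣ n * (n + H)}

/-- The ratio of excluded to remaining residues modulo `p`. -/
noncomputable def excludedRatio (H p : ℕ) : ℝ :=
  excludedCount H p / (p - excludedCount H p)

/-- The mean-zero function modulo `p` equal to `-1` on the excluded residues and constant on the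
remaining ones. -/
noncomputable def sieveLocal (H p n : ℕ) : ℝ :=
  if p ∣ n * (n + H) then -1 else excludedRatio H p

theorem excludedCount_eq (H : ℕ) {p : ℕ} (hp : p.Prime) :
    excludedCount H p = if p ∣ H then 1 else 2 := by
  obtain ⟨c, hcp, hc⟩ : ∃ c < p, p ∣ c + H := by
    -- This is the residue of -H; it coincides with 0 exactly when p divides H.
    refine ⟨(p - H % p) % p, Nat.mod_lt _ hp.pos, ?_⟩
    rw [Nat.dvd_iff_mod_eq_zero, Nat.add_mod, Nat.mod_mod, ← Nat.add_mod, ← Nat.add_mod_mod,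
      Nat.sub_add_cancel (Nat.mod_lt _ hp.pos).le, Nat.mod_self]
  have hset : ({n ∈ range p | p ∣ n * (n + H)} : Finset ℕ) = {0, c} := by
    ext n
    simp only [mem_filter, mem_range, mem_insert, mem_singleton]
    constructor
    · rintro ⟨hn, hdvd⟩
      rcases hp.dvd_mul.1 hdvd with h | h
      · exact Or.inl (Nat.eq_zero_of_dvd_of_lt h hn)
      · refine Or.inr (Nat.ModEq.eq_of_lt_of_lt ?_ hn hcp)
        have h1 : n + H ≡ c + H [MOD p] :=
          ((Nat.modEq_zero_iff_dvd.2 h).trans (Nat.modEq_zero_iff_dvd.2 hc).symm)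
        exact Nat.ModEq.add_right_cancel' H h1
    · rintro (rfl | rfl)
      · exact ⟨hp.pos, by simp⟩
      · exact ⟨hcp, hc.mul_left _⟩
  rw [excludedCount, hset]
  split_ifs with hpH
  · have : c = 0 := Nat.eq_zero_of_dvd_of_lt ((Nat.dvd_add_left hpH).1 hc) hcp
    simp [this]
  · refine card_pair ?_
    rintro rfl
    exact hpH (by simpa using hc)

theorem one_le_excludedCount (H : ℕ) {p : ℕ} (hp : p.Prime) : (1 : ℝ) ≤ excludedCount H p := by
  rw [excludedCount_eq H hp]; split_ifs <;> norm_num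

theorem excludedCount_le_two (H : ℕ) {p : ℕ} (hp : p.Prime) : (excludedCount H p : ℝ) ≤ 2 := by
  rw [excludedCount_eq H hp]; split_ifs <;> norm_num

theorem three_le_of_prime_of_odd {p : ℕ} (hp : p.Prime) (hodd : Odd p) : (3 : ℝ) ≤ p := by
  have h2 := hp.two_le
  have : p ≠ 2 := by rintro rfl; exact absurd hodd (by decide)
  exact_mod_cast (by omega : 3 ≤ p)

/-- Only odd primes are sieved: for p = 2 and H odd every residue is excluded and the denominator p
- `excludedCount` vanishes. -/
theorem excludedRatio_nonneg (H : ℕ) {p : ℕ} (hp : p.Prime) (hodd : Odd p) :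
    0 ≤ excludedRatio H p :=
  div_nonneg (by positivity)
    (by linarith [excludedCount_le_two H hp, three_le_of_prime_of_odd hp hodd])

theorem le_excludedRatio (H : ℕ) {p : ℕ} (hp : p.Prime) (hodd : Odd p) :
    (if p ∣ H then 1 else 2 : ℝ) / p ≤ excludedRatio H p := by
  have h : (if p ∣ H then 1 else 2 : ℝ) = excludedCount H p := by
    rw [excludedCount_eq H hp]; split_ifs <;> norm_num
  rw [h, excludedRatio]
  have h2 := excludedCount_le_two H hp
  have h1 := one_le_excludedCount H hp
  have h3 := three_le_of_prime_of_odd hp hodd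
  gcongr <;> linarith

theorem excludedRatio_le_two (H : ℕ) {p : ℕ} (hp : p.Prime) (hodd : Odd p) :
    excludedRatio H p ≤ 2 := by
  have h2 := excludedCount_le_two H hp
  have h3 := three_le_of_prime_of_odd hp hodd
  rw [excludedRatio, div_le_iff₀ (by linarith)]
  linarith

theorem sieveLocal_periodic (H p : ℕ) : Function.Periodic (sieveLocal H p) p := by
  intro n
  have h : p ∣ (n + p) * (n + p + H) ↔ p ∣ n * (n + H) := by
    rw [show (n + p) * (n + p + H) = n * (n + H) + p * (2 * n + p + H) by ring]
    exact Nat.dvd_add_left (Dvd.intro _ rfl)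
  simp only [sieveLocal, h]

theorem abs_sieveLocal_le (H n : ℕ) {p : ℕ} (hp : p.Prime) (hodd : Odd p) :
    |sieveLocal H p n| ≤ p := by
  have h3 := three_le_of_prime_of_odd hp hodd
  unfold sieveLocal
  split_ifs
  · rw [abs_neg, abs_one]
    linarith
  · rw [abs_of_nonneg (excludedRatio_nonneg H hp hodd)]
    linarith [excludedRatio_le_two H hp hodd]

theorem sum_ite_dvd (H : ℕ) (p : ℕ) (u v : ℝ) :
    ∑ n ∈ range p, (if p ∣ n * (n + H) then u else v) =
      excludedCount H p * u + (p - excludedCount H p) * v := by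
  have h := card_filter_add_card_filter_not (s := range p) (fun n => p ∣ n * (n + H))
  rw [card_range] at h
  have h' : (#{n ∈ range p | ¬p ∣ n * (n + H)} : ℝ) = p - excludedCount H p := by
    rw [eq_sub_iff_add_eq, add_comm]
    exact_mod_cast h
  rw [sum_ite, sum_const, sum_const, nsmul_eq_mul, nsmul_eq_mul, h', excludedCount]

theorem sum_sieveLocal (H : ℕ) {p : ℕ} (hp : p.Prime) (hodd : Odd p) :
    ∑ n ∈ range p, sieveLocal H p n = 0 := by
  have h2 := excludedCount_le_two H hp
  have h3 := three_le_of_prime_of_odd hp hodd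
  have h : (p : ℝ) - excludedCount H p ≠ 0 := by linarith
  simp only [sieveLocal, sum_ite_dvd, excludedRatio]
  field_simp
  ring

/-- With ρ excluded residues, ρ + ρ²/(p - ρ) = p · ρ/(p - ρ). Thus the mean square equals the value
on the remaining residues, as the sieve requires. -/
theorem sum_sieveLocal_mul_self (H : ℕ) {p : ℕ} (hp : p.Prime) (hodd : Odd p) :
    ∑ n ∈ range p, sieveLocal H p n * sieveLocal H p n = p * excludedRatio H p := by
  have h2 := excludedCount_le_two H hp
  have h3 := three_le_of_prime_of_odd hp hodd
  have h : (p : ℝ) - excludedCount H p ≠ 0 := by linarith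
  have hsq : ∀ n, sieveLocal H p n * sieveLocal H p n =
      if p ∣ n * (n + H) then 1 else excludedRatio H p * excludedRatio H p := by
    intro n
    unfold sieveLocal
    split_ifs <;> ring
  simp only [hsq, sum_ite_dvd, excludedRatio]
  field_simp
  ring

/-- Selberg's upper bound for the number of prime pairs with difference `H`. -/
theorem exists_card_prime_pairs_le : ∃ C : ℝ, 0 < C ∧ ∀ H : ℕ, H ≠ 0 → ∀ N : ℕ, 1 ≤ N →
    (#{n ∈ range N | n.Prime ∧ (n + H).Prime} : ℝ) * Real.log N ^ 2 ≤
      C * (H / H.totient) * N := by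
  set Z := ∑' n : ℕ, ((n : ℝ) ^ 2)⁻¹ with hZ
  have hZ0 : 0 ≤ Z := tsum_nonneg fun _ => by positivity
  -- 2304 = 24² · 4, from log N ≤ 24 log(y + 1) and the 4 in `totient_div_mul_log_sq_le`; 32 = 2 ·
  -- 16 pays for two terms √N.
  refine ⟨2304 * Z ^ 3 + 32, by positivity, fun H hH N hN => ?_⟩
  have hN1 : (1 : ℝ) ≤ N := by exact_mod_cast hN
  have hφ : (0 : ℝ) < H.totient := by exact_mod_cast Nat.totient_pos.2 (Nat.pos_of_ne_zero hH)
  have hH0 : (0 : ℝ) < H := by exact_mod_cast Nat.pos_of_ne_zero hH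
  have hHφ : 1 ≤ (H : ℝ) / H.totient := by
    rw [one_le_div hφ]
    exact_mod_cast Nat.totient_le H
  -- The sieve has level z = y², so its error z⁶ = y¹² is at most √N.
  set y := ⌊(N : ℝ) ^ (1 / 24 : ℝ)⌋₊ with hy
  have hy1 : 1 ≤ y := Nat.le_floor (by simpa using Real.one_le_rpow hN1 (by norm_num))
  have hyN : (y : ℝ) ^ 12 ≤ √N := by
    calc (y : ℝ) ^ 12 ≤ ((N : ℝ) ^ (1 / 24 : ℝ)) ^ 12 := by
          gcongr
          exact Nat.floor_le (by positivity)
      _ = √N := by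
          rw [← Real.rpow_natCast, ← Real.rpow_mul (by positivity), Real.sqrt_eq_rpow]
          norm_num
  have hlog : Real.log N ≤ 24 * Real.log (y + 1) := by
    have h : Real.log ((N : ℝ) ^ (1 / 24 : ℝ)) ≤ Real.log (y + 1) :=
      Real.log_le_log (by positivity) (Nat.lt_floor_add_one _).le
    rw [Real.log_rpow (by linarith)] at h
    linarith
  have hlog0 : 0 ≤ Real.log N := Real.log_nonneg hN1
  set D : Finset ℕ := {d ∈ Icc 1 (y ^ 2) | Squarefree d ∧ Odd d} with hD
  set P : Finset ℕ := {p ∈ Icc 1 (y ^ 2) | p.Prime ∧ Odd p} with hPdef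
  set G := ∑ d ∈ D, ∏ p ∈ d.primeFactors, excludedRatio H p with hG
  have hP : ∀ p ∈ P, p.Prime ∧ Odd p := fun p hp => (mem_filter.1 hp).2
  have hG1 : 1 ≤ G := by
    have h1 : (1 : ℕ) ∈ D := by simpa [hD] using Nat.one_le_pow 2 y hy1
    have h := single_le_sum (f := fun d => ∏ p ∈ d.primeFactors, excludedRatio H p)
      (fun d hd => prod_nonneg fun p hp => excludedRatio_nonneg H
        (Nat.prime_of_mem_primeFactors hp)
        ((mem_filter.1 hd).2.2.of_dvd_nat (Nat.dvd_of_mem_primeFactors hp))) h1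
    simpa using h
  -- A prime n ≤ y² may itself be a sieving prime; these n are set aside and number at most y² ≤ √N.
  set S : Finset ℕ := {n ∈ range N | n.Prime ∧ (n + H).Prime ∧ y ^ 2 < n} with hSdef
  have hsieve : (#S : ℝ) * G ^ 2 ≤ N * G + ((y ^ 2 : ℕ) : ℝ) ^ 6 := by
    refine card_sifted_mul_sq_le (P := P) (a := sieveLocal H) (fun p hp => (hP p hp).1)
      (fun p _ => sieveLocal_periodic H p)
      (fun p hp n => abs_sieveLocal_le H n (hP p hp).1 (hP p hp).2)
      (fun p hp => sum_sieveLocal H (hP p hp).1 (hP p hp).2)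
      (fun p hp => sum_sieveLocal_mul_self H (hP p hp).1 (hP p hp).2)
      (fun p hp => excludedRatio_nonneg H (hP p hp).1 (hP p hp).2) ?_ (filter_subset _ _) ?_
    · intro d hd
      simp only [hD, mem_filter, mem_Icc] at hd
      refine ⟨hd.2.1, hd.1.2, fun p hp => ?_⟩
      have hpp := Nat.prime_of_mem_primeFactors hp
      simp only [hPdef, mem_filter, mem_Icc]
      exact ⟨⟨hpp.pos, (Nat.le_of_mem_primeFactors hp).trans hd.1.2⟩, hpp,
        hd.2.2.of_dvd_nat (Nat.dvd_of_mem_primeFactors hp)⟩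
    · intro n hn p hp
      simp only [hSdef, mem_filter] at hn
      simp only [hPdef, mem_filter, mem_Icc] at hp
      refine if_neg fun hdvd => ?_
      rcases hp.2.1.dvd_mul.1 hdvd with h | h
      · have := (Nat.prime_dvd_prime_iff_eq hp.2.1 hn.2.1).1 h
        omega
      · have := (Nat.prime_dvd_prime_iff_eq hp.2.1 hn.2.2.1).1 h
        omega
  have hcard : (#{n ∈ range N | n.Prime ∧ (n + H).Prime} : ℝ) ≤ #S + √N := by
    have h1 : ({n ∈ range N | n.Prime ∧ (n + H).Prime} : Finset ℕ) ⊆ S ∪ Icc 1 (y ^ 2) := by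
      intro n hn
      simp only [mem_filter] at hn
      simp only [hSdef, mem_union, mem_filter, mem_Icc]
      have := hn.2.1.pos
      by_cases h : y ^ 2 < n
      · exact Or.inl ⟨hn.1, hn.2.1, hn.2.2, h⟩
      · exact Or.inr ⟨this, not_lt.1 h⟩
    have h2 := (card_le_card h1).trans (card_union_le _ _)
    rw [Nat.card_Icc, Nat.add_sub_cancel] at h2
    calc (#{n ∈ range N | n.Prime ∧ (n + H).Prime} : ℝ) ≤ #S + (y : ℝ) ^ 2 := by
          exact_mod_cast h2
      _ ≤ #S + (y : ℝ) ^ 12 := by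
          gcongr
          · exact_mod_cast hy1
          · norm_num
      _ ≤ #S + √N := by gcongr
  have hS : (#S : ℝ) ≤ N / G + √N := by
    have h1 : (#S : ℝ) * G ^ 2 ≤ (N / G + √N) * G ^ 2 := by
      calc (#S : ℝ) * G ^ 2 ≤ N * G + (y : ℝ) ^ 12 := by
            refine hsieve.trans (le_of_eq ?_)
            push_cast
            ring
        _ ≤ N * G + √N * G ^ 2 := by
            have : 1 ≤ G ^ 2 := one_le_pow₀ hG1
            nlinarith [Real.sqrt_nonneg (N : ℝ)]
        _ = (N / G + √N) * G ^ 2 := by field_simp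
    exact le_of_mul_le_mul_right h1 (by positivity)
  have hGlow := totient_div_mul_log_sq_le y hH
    (fun p hp hodd => le_excludedRatio H hp hodd)
  rw [← hZ, ← hD, ← hG] at hGlow
  have hmain : (N : ℝ) / G * Real.log N ^ 2 ≤ 2304 * Z ^ 3 * (H / H.totient) * N := by
    have h1 : Real.log N ^ 2 ≤ 2304 * Z ^ 3 * (H / H.totient) * G := by
      calc Real.log N ^ 2 ≤ (24 * Real.log (y + 1)) ^ 2 := by gcongr
        _ = 576 * (H / H.totient) * ((H.totient : ℝ) / H * Real.log (y + 1) ^ 2) := by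
            field_simp; ring
        _ ≤ 576 * (H / H.totient) * (4 * Z ^ 3 * G) := by gcongr
        _ = _ := by ring
    calc (N : ℝ) / G * Real.log N ^ 2 ≤ N / G * (2304 * Z ^ 3 * (H / H.totient) * G) := by
          gcongr
      _ = _ := by field_simp
  have hsqrt : √N * Real.log N ^ 2 ≤ 16 * (H / H.totient) * N := by
    have h1 : Real.log N ≤ 4 * (N : ℝ) ^ (1 / 4 : ℝ) := by
      have := Real.log_le_rpow_div (x := N) (by positivity) (ε := 1 / 4) (by norm_num)
      linarith
    calc √N * Real.log N ^ 2 ≤ √N * (4 * (N : ℝ) ^ (1 / 4 : ℝ)) ^ 2 := by gcongr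
      _ = 16 * (√N * √N) := by
          rw [mul_pow, ← Real.rpow_natCast ((N : ℝ) ^ (1 / 4 : ℝ)), ← Real.rpow_mul (by positivity),
            Real.sqrt_eq_rpow]
          norm_num
          ring
      _ = 16 * N := by rw [Real.mul_self_sqrt (by positivity)]
      _ ≤ 16 * (H / H.totient) * N := by nlinarith
  calc (#{n ∈ range N | n.Prime ∧ (n + H).Prime} : ℝ) * Real.log N ^ 2
      ≤ (N / G + √N + √N) * Real.log N ^ 2 := by gcongr; linarith
    _ = N / G * Real.log N ^ 2 + 2 * (√N * Real.log N ^ 2) := by ring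
    _ ≤ 2304 * Z ^ 3 * (H / H.totient) * N + 2 * (16 * (H / H.totient) * N) := by gcongr
    _ = _ := by ring

end PrimePairs

/-! ### Elementary totient estimates and Chebyshev bounds. -/

section TotientAndPrimes

open Finset

/-- The factor 2 is needed only at the prime 2, since p ≤ (p - 1)² for p ≥ 3. The induction carries
the sharper odd case because at most one of two coprime factors is even. -/
theorem le_two_mul_totient_sq (n : ℕ) : n ≤ 2 * n.totient ^ 2 := by
  suffices h : n ≤ 2 * n.totient ^ 2 ∧ (Odd n → n ≤ n.totient ^ 2) from h.1
  induction n using Nat.recOnPosPrimePosCoprime with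
  | prime_pow p k hp hk =>
    obtain ⟨m, rfl⟩ : ∃ m, k = m + 1 := ⟨k - 1, by omega⟩
    rw [Nat.totient_prime_pow_succ hp]
    obtain ⟨r, rfl⟩ : ∃ r, p = r + 1 := ⟨p - 1, by have := hp.pos; omega⟩
    rw [Nat.add_sub_cancel, pow_succ]
    have h1 : 1 ≤ (r + 1) ^ m := Nat.one_le_pow _ _ hp.pos
    have h2 : (r + 1) ^ m ≤ ((r + 1) ^ m) ^ 2 := by nlinarith
    have h3 : 1 ≤ r := by have := hp.two_le; omega
    have hodd : Odd ((r + 1) ^ m * (r + 1)) → 2 ≤ r := by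
      intro h
      by_contra hr
      have : r = 1 := by omega
      subst this
      exact absurd (Nat.odd_mul.1 h).2 (by decide)
    rw [mul_pow, ← mul_assoc]
    refine ⟨?_, fun h => ?_⟩
    · have : r + 1 ≤ 2 * r ^ 2 := by nlinarith
      calc (r + 1) ^ m * (r + 1) ≤ ((r + 1) ^ m) ^ 2 * (2 * r ^ 2) := Nat.mul_le_mul h2 this
        _ = _ := by ring
    · have : r + 1 ≤ r ^ 2 := by nlinarith [hodd h]
      exact Nat.mul_le_mul h2 this
  | zero => simp
  | one => simp
  | coprime a b _ _ hab iha ihb =>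
    rw [Nat.totient_mul hab, mul_pow]
    refine ⟨?_, fun h => ?_⟩
    · by_cases ha : Odd a
      · calc a * b ≤ a.totient ^ 2 * (2 * b.totient ^ 2) := Nat.mul_le_mul (iha.2 ha) ihb.1
          _ = _ := by ring
      · have hb : Odd b := by
          by_contra hb
          rw [Nat.not_odd_iff_even] at ha hb
          exact absurd (Nat.eq_one_of_dvd_coprimes hab ha.two_dvd hb.two_dvd) (by norm_num)
        calc a * b ≤ (2 * a.totient ^ 2) * b.totient ^ 2 := Nat.mul_le_mul iha.1 (ihb.2 hb)
          _ = _ := by ring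
    · exact Nat.mul_le_mul (iha.2 (Nat.odd_mul.1 h).1) (ihb.2 (Nat.odd_mul.1 h).2)

theorem sqrt_le_two_mul_totient (n : ℕ) : √(n : ℝ) ≤ 2 * n.totient := by
  rw [Real.sqrt_le_left (by positivity)]
  have h : (n : ℝ) ≤ 2 * (n.totient : ℝ) ^ 2 := by exact_mod_cast le_two_mul_totient_sq n
  nlinarith [sq_nonneg (n.totient : ℝ)]

theorem inv_totient_prod {T : Finset ℕ} (hT : ∀ p ∈ T, p.Prime) :
    ((∏ p ∈ T, p).totient : ℝ)⁻¹ = ∏ p ∈ T, ((p : ℝ) - 1)⁻¹ := by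
  have h0 : ∏ p ∈ T, p ≠ 0 := prod_ne_zero_iff.2 fun p hp => (hT p hp).ne_zero
  have h := totient_div_eq_prod _ h0
  rw [Nat.primeFactors_prod hT, div_eq_iff (by exact_mod_cast h0), Nat.cast_prod,
    ← prod_mul_distrib] at h
  rw [h, ← prod_inv_distrib]
  refine prod_congr rfl fun p hp => ?_
  have : (p : ℝ) ≠ 0 := by exact_mod_cast (hT p hp).ne_zero
  field_simp

/-- Expanding ∏ (1 + 1/(p - 1)) over p ∣ k gives the sum of 1/φ(d) over squarefree d ∣ k only. -/
theorem div_totient_le_sum_divisors {k : ℕ} (hk : k ≠ 0) :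
    (k : ℝ) / k.totient ≤ ∑ d ∈ k.divisors, (d.totient : ℝ)⁻¹ := by
  have hpr : ∀ T ∈ k.primeFactors.powerset, ∀ p ∈ T, p.Prime := fun T hT p hp =>
    Nat.prime_of_mem_primeFactors (mem_powerset.1 hT hp)
  calc (k : ℝ) / k.totient = ∏ p ∈ k.primeFactors, (1 + ((p : ℝ) - 1)⁻¹) := by
        rw [← inv_div, totient_div_eq_prod k hk, ← prod_inv_distrib]
        refine prod_congr rfl fun p hp => ?_
        have h1 : (1 : ℝ) < p := by exact_mod_cast (Nat.prime_of_mem_primeFactors hp).one_lt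
        have h2 : (p : ℝ) - 1 ≠ 0 := by linarith
        have h3 : (p : ℝ) ≠ 0 := by linarith
        field_simp
        ring
    _ = ∑ T ∈ k.primeFactors.powerset, ∏ p ∈ T, ((p : ℝ) - 1)⁻¹ := prod_one_add _
    _ ≤ ∑ d ∈ k.divisors, (d.totient : ℝ)⁻¹ := by
        refine sum_le_sum_of_injOn' (fun T => ∏ p ∈ T, p) ?_ ?_ ?_ ?_
        · intro T hT
          exact Nat.mem_divisors.2 ⟨(prod_dvd_prod_of_subset _ _ _ (mem_powerset.1 hT)).trans
            (Nat.prod_primeFactors_dvd k), hk⟩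
        · intro T hT U hU hTU
          rw [← Nat.primeFactors_prod (hpr T hT), ← Nat.primeFactors_prod (hpr U hU)]
          exact congrArg Nat.primeFactors hTU
        · intro T hT
          exact (inv_totient_prod (hpr T hT)).ge
        · intro d _
          positivity

/-- After exchanging sums, d contributes at most K/(d φ(d)), and φ(d) ≥ √d/2 makes the series
converge. -/
theorem exists_sum_div_totient_le : ∃ C : ℝ, 0 < C ∧ ∀ K : ℕ,
    ∑ k ∈ Icc 1 K, (k : ℝ) / k.totient ≤ C * K := by
  have hsum : Summable fun n : ℕ => ((n : ℝ) ^ (3 / 2 : ℝ))⁻¹ :=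
    Real.summable_nat_rpow_inv.2 (by norm_num)
  have hZ0 : 0 ≤ ∑' n : ℕ, ((n : ℝ) ^ (3 / 2 : ℝ))⁻¹ := tsum_nonneg fun _ => by positivity
  refine ⟨2 * (∑' n : ℕ, ((n : ℝ) ^ (3 / 2 : ℝ))⁻¹) + 1, by positivity, fun K => ?_⟩
  calc ∑ k ∈ Icc 1 K, (k : ℝ) / k.totient
      ≤ ∑ k ∈ Icc 1 K, ∑ d ∈ Icc 1 K with d ∣ k, (d.totient : ℝ)⁻¹ := by
        refine sum_le_sum fun k hk => ?_
        rw [mem_Icc] at hk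
        refine (div_totient_le_sum_divisors (by omega)).trans (le_of_eq (sum_congr ?_ fun _ _ => rfl))
        ext d
        simp only [Nat.mem_divisors, mem_filter, mem_Icc]
        refine ⟨fun h => ⟨⟨Nat.pos_of_dvd_of_pos h.1 hk.1, (Nat.le_of_dvd hk.1 h.1).trans hk.2⟩,
          h.1⟩, fun h => ⟨h.2, by omega⟩⟩
    _ = ∑ d ∈ Icc 1 K, ∑ k ∈ Icc 1 K with d ∣ k, (d.totient : ℝ)⁻¹ := by
        simp_rw [sum_filter]
        exact sum_comm
    _ ≤ ∑ d ∈ Icc 1 K, 2 * K * ((d : ℝ) ^ (3 / 2 : ℝ))⁻¹ := by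
        refine sum_le_sum fun d hd => ?_
        rw [mem_Icc] at hd
        have hd0 : (0 : ℝ) < d := by exact_mod_cast hd.1
        have hcard : #{k ∈ Icc 1 K | d ∣ k} = K / d := Nat.Ioc_filter_dvd_card_eq_div K d
        rw [sum_const, nsmul_eq_mul, hcard]
        have hφ : (d.totient : ℝ)⁻¹ ≤ 2 * (√(d : ℝ))⁻¹ := by
          have h1 := sqrt_le_two_mul_totient d
          have h2 : 0 < √(d : ℝ) := Real.sqrt_pos.2 hd0
          have h3 : (0 : ℝ) < d.totient := by linarith
          rw [inv_le_iff_one_le_mul₀ h3, mul_assoc, ← div_eq_inv_mul, ← mul_div_assoc,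
            one_le_div h2]
          exact h1
        calc ((K / d : ℕ) : ℝ) * (d.totient : ℝ)⁻¹ ≤ (K / d) * (2 * (√(d : ℝ))⁻¹) := by
              gcongr
              exact Nat.cast_div_le
          _ = 2 * K * (d * √(d : ℝ))⁻¹ := by
              rw [mul_inv]; ring
          _ = 2 * K * ((d : ℝ) ^ (3 / 2 : ℝ))⁻¹ := by
              rw [show (3 / 2 : ℝ) = 1 + 1 / 2 by norm_num, Real.rpow_add hd0, Real.rpow_one,
                Real.sqrt_eq_rpow]
    _ = 2 * (∑ d ∈ Icc 1 K, ((d : ℝ) ^ (3 / 2 : ℝ))⁻¹) * K := by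
        rw [← mul_sum]; ring
    _ ≤ (2 * (∑' n : ℕ, ((n : ℝ) ^ (3 / 2 : ℝ))⁻¹) + 1) * K := by
        have := hsum.sum_le_tsum (Icc 1 K) fun _ _ => by positivity
        gcongr
        linarith

theorem card_primes_mul_log_le {N : ℕ} (hN : 2 ≤ N) :
    (#{p ∈ range N | p.Prime} : ℝ) * Real.log N ≤ 6 * N := by
  have hN1 : (1 : ℝ) < N := by exact_mod_cast hN
  have hlog : 0 < Real.log N := Real.log_pos hN1
  have h := Chebyshev.pi_le_log4_mul_div hN1
  rw [Nat.floor_natCast, Real.log_sqrt (by positivity)] at h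
  have hle : (#{p ∈ range N | p.Prime} : ℝ) ≤ Nat.primeCounting N := by
    have h1 : #{p ∈ range N | p.Prime} = Nat.primeCounting' N := by
      rw [Nat.primeCounting', Nat.count_eq_card_filter_range]
    rw [h1]
    exact_mod_cast Nat.monotone_primeCounting' (Nat.le_succ N)
  have hl4 : Real.log 4 ≤ 2 := by
    rw [show (4 : ℝ) = 2 ^ 2 by norm_num, Real.log_pow]
    have := Real.log_two_lt_d9
    push_cast
    linarith
  have hs : √(N : ℝ) * Real.log N ≤ 2 * N := by
    have h1 : Real.log N ≤ 2 * √(N : ℝ) := by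
      have := Real.log_le_rpow_div (x := N) (by positivity) (ε := 1 / 2) (by norm_num)
      rw [← Real.sqrt_eq_rpow] at this
      linarith
    nlinarith [Real.mul_self_sqrt (Nat.cast_nonneg (α := ℝ) N), Real.sqrt_nonneg (N : ℝ)]
  calc (#{p ∈ range N | p.Prime} : ℝ) * Real.log N
      ≤ (Real.log 4 * N / (Real.log N / 2) + √(N : ℝ)) * Real.log N := by
        gcongr; exact hle.trans h
    _ = 2 * Real.log 4 * N + √(N : ℝ) * Real.log N := by field_simp
    _ ≤ 2 * 2 * N + 2 * N := by gcongr
    _ = 6 * N := by ring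

theorem eventually_le_card_primes_mul_log : ∀ᶠ N : ℕ in Filter.atTop,
    1 / 2 * (N : ℝ) ≤ #{p ∈ range N | p.Prime} * Real.log N := by
  have hlo : ∀ᶠ N : ℕ in Filter.atTop, ‖Real.log N‖ ≤ 1 / 20 * ‖(N : ℝ)‖ :=
    (Real.isLittleO_log_id_atTop.comp_tendsto tendsto_natCast_atTop_atTop).bound (by norm_num)
  filter_upwards [hlo, Filter.eventually_ge_atTop 20] with N hN hN20
  have hN20' : (20 : ℝ) ≤ N := by exact_mod_cast hN20
  rw [Real.norm_of_nonneg (Real.log_nonneg (by linarith)), Real.norm_of_nonneg (by positivity)]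
    at hN
  have hlog : 0 < Real.log N := Real.log_pos (by linarith)
  have hpi := Chebyshev.pi_ge N
  rw [div_le_iff₀ hlog] at hpi
  -- `primeCounting` includes N itself while `range N` stops before it.
  have hle : (Nat.primeCounting N : ℝ) ≤ #{p ∈ range N | p.Prime} + 1 := by
    have h1 : Nat.primeCounting N ≤ #{p ∈ range N | p.Prime} + 1 := by
      rw [Nat.primeCounting, Nat.primeCounting', Nat.count_eq_card_filter_range, range_add_one,
        filter_insert]
      split_ifs
      · exact card_insert_le _ _
      · omega
    exact_mod_cast h1
  have hl1 : Real.log (N + 1) ≤ Real.log N + 1 / 20 := by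
    have h1 : Real.log ((N + 1) / N) ≤ (N + 1) / N - 1 := Real.log_le_sub_one_of_pos (by positivity)
    rw [Real.log_div (by positivity) (by positivity), add_div, div_self (by positivity)] at h1
    have : 1 / (N : ℝ) ≤ 1 / 20 := by gcongr
    linarith
  have hl2 := Real.log_two_gt_d9
  nlinarith

end TotientAndPrimes

/-! ### Counting residue classes: second moment and converse. -/

section ResidueClasses

open Finset

theorem primeClasses_eq_image (q : ℕ) (X : ℝ) :
    primeClasses q X = (fun p : ℕ => (p : ZMod q)) '' ({p ∈ range ⌈X⌉₊ | p.Prime} : Finset ℕ) := by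
  ext a
  simp only [primeClasses, Set.mem_ofPred_eq, Set.mem_image, coe_filter, mem_range, Nat.lt_ceil]
  exact ⟨fun ⟨p, h1, h2, h3⟩ => ⟨p, ⟨h2, h1⟩, h3⟩, fun ⟨p, ⟨h2, h1⟩, h3⟩ => ⟨p, h1, h2, h3⟩⟩

/-- For q = 0 the ring is ℤ, so finiteness comes from the primes below X. -/
theorem finite_primeClasses (q : ℕ) (X : ℝ) : (primeClasses q X).Finite := by
  rw [primeClasses_eq_image]
  exact (finite_toSet _).image _

theorem ncard_primeClasses_le (q : ℕ) (X : ℝ) :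
    (primeClasses q X).ncard ≤ #{p ∈ range ⌈X⌉₊ | p.Prime} := by
  rw [primeClasses_eq_image, ← Set.ncard_coe_finset {p ∈ range ⌈X⌉₊ | p.Prime}]
  exact Set.ncard_image_le (finite_toSet _)

theorem primeClasses_mono (q : ℕ) {X Y : ℝ} (h : X ≤ Y) : primeClasses q X ⊆ primeClasses q Y :=
  fun _ ⟨p, hp, hpX, ha⟩ => ⟨p, hp, hpX.trans_le h, ha⟩

theorem reducedPrimeClasses_subset (q : ℕ) (X : ℝ) : reducedPrimeClasses q X ⊆ primeClasses q X :=
  fun _ h => h.1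

theorem card_image_le_ncard_reducedPrimeClasses (q : ℕ) (X : ℝ) :
    #({p ∈ range ⌈X⌉₊ | p.Prime ∧ p.Coprime q}.image fun p : ℕ => (p : ZMod q)) ≤
      (reducedPrimeClasses q X).ncard := by
  rw [← Set.ncard_coe_finset]
  refine Set.ncard_le_ncard ?_ ((finite_primeClasses q X).subset (reducedPrimeClasses_subset q X))
  intro a ha
  simp only [coe_image, Set.mem_image, coe_filter, mem_range, Nat.lt_ceil,
    Set.mem_ofPred_eq] at ha
  obtain ⟨p, ⟨h1, h2, h3⟩, rfl⟩ := ha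
  exact ⟨⟨p, h2, h1, rfl⟩, (ZMod.isUnit_iff_coprime p q).2 h3⟩

/-- Pairs with equal image number the sum of the squared fibre sizes; Cauchy–Schwarz over the image
does the rest. -/
theorem card_sq_le_card_image_mul {α β : Type*} [DecidableEq β] (S : Finset α) (f : α → β) :
    #S ^ 2 ≤ #(S.image f) * #{x ∈ S ×ˢ S | f x.1 = f x.2} := by
  have h1 : #{x ∈ S ×ˢ S | f x.1 = f x.2} = ∑ b ∈ S.image f, #{x ∈ S | f x = b} ^ 2 := by
    rw [card_eq_sum_card_fiberwise (f := fun x => f x.1) (t := S.image f)]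
    · refine sum_congr rfl fun b _ => ?_
      rw [sq, ← card_product]
      congr 1
      ext x
      simp only [mem_filter, mem_product]
      constructor
      · rintro ⟨⟨⟨h1, h2⟩, h3⟩, h4⟩
        exact ⟨⟨h1, h4⟩, h2, h3 ▸ h4⟩
      · rintro ⟨⟨h1, h4⟩, h2, h3⟩
        exact ⟨⟨⟨h1, h2⟩, h4.trans h3.symm⟩, h4⟩
    · intro x hx
      simp only [coe_filter, Set.mem_ofPred_eq, mem_product] at hx
      exact mem_coe.2 (mem_image_of_mem f hx.1.1)
  rw [h1, card_eq_sum_card_image f S]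
  exact sq_sum_le_card_mul_sum_sq

/-- The diagonal gives `#S`; a pair with x.1 < x.2 is determined by x.1 and k = (x.2 - x.1)/q, and
symmetry doubles the count. -/
theorem card_congruent_pairs_le {q : ℕ} (hq : 0 < q) (N : ℕ) {S : Finset ℕ}
    (hS : S ⊆ {p ∈ range N | p.Prime}) :
    #{x ∈ S ×ˢ S | (x.1 : ZMod q) = (x.2 : ZMod q)} ≤
      #S + 2 * ∑ k ∈ Icc 1 (N / q), #{n ∈ range N | n.Prime ∧ (n + k * q).Prime} := by
  set U : Finset (ℕ × ℕ) := {x ∈ S ×ˢ S | (x.1 : ZMod q) = (x.2 : ZMod q)} with hU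
  set V : Finset (Σ _ : ℕ, ℕ) := (Icc 1 (N / q)).sigma
    fun k => {n ∈ range N | n.Prime ∧ (n + k * q).Prime} with hV
  have hlt : #{x ∈ U | x.1 < x.2} ≤ #V := by
    refine card_le_card_of_injOn (fun x => ⟨(x.2 - x.1) / q, x.1⟩) ?_ ?_
    · intro x hx
      simp only [hU, coe_filter, Set.mem_ofPred_eq, mem_filter, mem_product] at hx
      obtain ⟨⟨⟨h1, h2⟩, h3⟩, h4⟩ := hx
      have h1' := hS h1
      have h2' := hS h2
      rw [mem_filter, mem_range] at h1' h2'
      obtain ⟨k, hk⟩ := (Nat.modEq_iff_dvd' h4.le).1 ((ZMod.natCast_eq_natCast_iff _ _ _).1 h3)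
      simp only [hV, mem_coe, mem_sigma, mem_Icc, mem_filter, mem_range]
      rw [hk, Nat.mul_div_cancel_left _ hq]
      refine ⟨⟨Nat.pos_of_ne_zero ?_, ?_⟩, h1'.1, h1'.2, ?_⟩
      · rintro rfl
        omega
      · rw [Nat.le_div_iff_mul_le hq, mul_comm, ← hk]
        omega
      · rw [mul_comm, ← hk, Nat.add_sub_cancel' h4.le]
        exact h2'.2
    · intro x hx w hw hxw
      simp only [hU, coe_filter, Set.mem_ofPred_eq, mem_filter, mem_product] at hx hw
      simp only [Sigma.mk.injEq, heq_eq_eq] at hxw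
      have hx3 := (Nat.modEq_iff_dvd' hx.2.le).1 ((ZMod.natCast_eq_natCast_iff _ _ _).1 hx.1.2)
      have hw3 := (Nat.modEq_iff_dvd' hw.2.le).1 ((ZMod.natCast_eq_natCast_iff _ _ _).1 hw.1.2)
      have h : x.2 - x.1 = w.2 - w.1 := by
        rw [← Nat.div_mul_cancel hx3, ← Nat.div_mul_cancel hw3, hxw.1]
      refine Prod.ext hxw.2 ?_
      have := hx.2
      have := hw.2
      have := hxw.2
      omega
  have hgt : #{x ∈ U | x.2 < x.1} = #{x ∈ U | x.1 < x.2} := by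
    refine card_nbij' Prod.swap Prod.swap ?_ ?_ (fun _ _ => rfl) (fun _ _ => rfl)
    all_goals
      intro x hx
      simp only [hU, coe_filter, Set.mem_ofPred_eq, mem_filter, mem_product, Prod.fst_swap,
        Prod.snd_swap] at hx ⊢
      exact ⟨⟨⟨hx.1.1.2, hx.1.1.1⟩, hx.1.2.symm⟩, hx.2⟩
  have hsub : U ⊆ S.image (fun p => (p, p)) ∪ ({x ∈ U | x.1 < x.2} ∪ {x ∈ U | x.2 < x.1}) := by
    intro x hx
    rcases lt_trichotomy x.1 x.2 with h | h | h
    · simp [hx, h]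
    · refine mem_union_left _ (mem_image.2 ⟨x.1, ?_, Prod.ext rfl h⟩)
      exact (mem_product.1 (mem_filter.1 hx).1).1
    · simp [hx, h]
  have hcardV : #V = ∑ k ∈ Icc 1 (N / q), #{n ∈ range N | n.Prime ∧ (n + k * q).Prime} :=
    card_sigma _ _
  have h1 := card_le_card hsub
  have h2 := card_union_le (S.image fun p => (p, p))
    ({x ∈ U | x.1 < x.2} ∪ {x ∈ U | x.2 < x.1})
  have h3 := card_union_le {x ∈ U | x.1 < x.2} {x ∈ U | x.2 < x.1}
  have h4 : #(S.image fun p => (p, p)) ≤ #S := card_image_le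
  omega

/-- As φ(kq) ≥ φ(k) φ(q), the singular factor separates into q/φ(q) and k/φ(k); averaging over k ≤
N/q cancels the q. -/
theorem exists_sum_card_prime_pairs_le : ∃ C : ℝ, 0 < C ∧ ∀ q : ℕ, 0 < q → ∀ N : ℕ, 1 ≤ N →
    ((∑ k ∈ Icc 1 (N / q), #{n ∈ range N | n.Prime ∧ (n + k * q).Prime} : ℕ) : ℝ) *
      Real.log N ^ 2 ≤ C * N ^ 2 / q.totient := by
  obtain ⟨C₁, hC₁, h₁⟩ := exists_card_prime_pairs_le
  obtain ⟨C₂, hC₂, h₂⟩ := exists_sum_div_totient_le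
  refine ⟨C₁ * C₂, by positivity, fun q hq N hN => ?_⟩
  have hq0 : (0 : ℝ) < q := by exact_mod_cast hq
  have hφq : (0 : ℝ) < q.totient := by exact_mod_cast Nat.totient_pos.2 hq
  calc ((∑ k ∈ Icc 1 (N / q), #{n ∈ range N | n.Prime ∧ (n + k * q).Prime} : ℕ) : ℝ) *
      Real.log N ^ 2
      = ∑ k ∈ Icc 1 (N / q), (#{n ∈ range N | n.Prime ∧ (n + k * q).Prime} : ℝ) *
          Real.log N ^ 2 := by
        rw [Nat.cast_sum, sum_mul]
    _ ≤ ∑ k ∈ Icc 1 (N / q), C₁ * (q / q.totient) * N * ((k : ℝ) / k.totient) := by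
        refine sum_le_sum fun k hk => ?_
        have hk0 : 0 < k := (mem_Icc.1 hk).1
        have hφk : (0 : ℝ) < k.totient := by exact_mod_cast Nat.totient_pos.2 hk0
        have hφ : (k.totient : ℝ) * q.totient ≤ (k * q).totient := by
          exact_mod_cast Nat.totient_super_multiplicative k q
        calc _ ≤ C₁ * ((k * q : ℕ) / (k * q).totient) * N := h₁ (k * q) (by positivity) N hN
          _ ≤ C₁ * ((k * q : ℕ) / (k.totient * q.totient)) * N := by gcongr
          _ = _ := by push_cast; field_simp
    _ = C₁ * (q / q.totient) * N * ∑ k ∈ Icc 1 (N / q), (k : ℝ) / k.totient := by rw [mul_sum]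
    _ ≤ C₁ * (q / q.totient) * N * (C₂ * (N / q)) := by
        gcongr
        refine (h₂ (N / q)).trans ?_
        gcongr
        exact Nat.cast_div_le
    _ = C₁ * C₂ * N ^ 2 / q.totient := by field_simp

theorem card_primeFactors_le_two_mul_log {q : ℕ} (hq : q ≠ 0) :
    (#q.primeFactors : ℝ) ≤ 2 * Real.log q := by
  have h : 2 ^ #q.primeFactors ≤ q := by
    calc 2 ^ #q.primeFactors ≤ ∏ p ∈ q.primeFactors, p :=
          pow_card_le_prod _ _ _ fun p hp => (Nat.prime_of_mem_primeFactors hp).two_le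
      _ ≤ q := Nat.le_of_dvd (Nat.pos_of_ne_zero hq) (Nat.prod_primeFactors_dvd q)
  have h' : ((2 : ℝ) ^ #q.primeFactors) ≤ q := by exact_mod_cast h
  have hlog := Real.log_le_log (by positivity) h'
  rw [Real.log_pow] at hlog
  have := Real.log_two_gt_d9
  have : (0 : ℝ) ≤ #q.primeFactors := by positivity
  nlinarith

theorem card_primes_le_card_coprime_add {q : ℕ} (hq : q ≠ 0) (N : ℕ) :
    #{p ∈ range N | p.Prime} ≤ #{p ∈ range N | p.Prime ∧ p.Coprime q} + #q.primeFactors := by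
  refine (card_le_card fun p hp => ?_).trans (card_union_le _ _)
  rw [mem_filter] at hp
  rw [mem_union, mem_filter, Nat.mem_primeFactors]
  by_cases h : p ∣ q
  · exact Or.inr ⟨hp.2, h, hq⟩
  · exact Or.inl ⟨hp.1, hp.2, (hp.2.coprime_iff_not_dvd).2 h⟩

/-- Only primes below Y are counted, so the sieve is applied at the threshold however large X is. -/
theorem card_coprime_primes_sq_le {q : ℕ} (hq : 0 < q) {X Y : ℝ} (hYX : Y ≤ X) :
    #{p ∈ range ⌈Y⌉₊ | p.Prime ∧ p.Coprime q} ^ 2 ≤ (reducedPrimeClasses q X).ncard *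
      (#{p ∈ range ⌈Y⌉₊ | p.Prime ∧ p.Coprime q} + 2 *
        ∑ k ∈ Icc 1 (⌈Y⌉₊ / q), #{n ∈ range ⌈Y⌉₊ | n.Prime ∧ (n + k * q).Prime}) := by
  refine (card_sq_le_card_image_mul _ fun p : ℕ => (p : ZMod q)).trans (Nat.mul_le_mul ?_
    (card_congruent_pairs_le hq _ (monotone_filter_right _ fun p _ hp => hp.1)))
  exact (card_image_le_ncard_reducedPrimeClasses q Y).trans (Set.ncard_le_ncard
    (fun a ha => ⟨primeClasses_mono q hYX ha.1, ha.2⟩)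
    ((finite_primeClasses q X).subset (reducedPrimeClasses_subset q X)))

/-- E is at most (B/c) s, so one factor s cancels from the second moment inequality. -/
theorem div_mul_le_of_sq_le {s f c B E R : ℝ} (hf : 0 < f) (hc : 0 < c) (hB : 0 ≤ B) (hR : 0 ≤ R)
    (hs : c * f ≤ s) (hE : E ≤ B * f) (h : s ^ 2 ≤ R * (s + E)) :
    c / (1 + B / c) * f ≤ R := by
  have hs0 : 0 < s := lt_of_lt_of_le (by positivity) hs
  have h1 : s + E ≤ s * (1 + B / c) := by
    have h2 : B * f = B / c * (c * f) := by field_simp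
    have h3 : B / c * (c * f) ≤ B / c * s := by gcongr
    linarith
  have h2 : s * s ≤ R * (1 + B / c) * s := by
    calc s * s ≤ R * (s + E) := by rw [← sq]; exact h
      _ ≤ R * (s * (1 + B / c)) := by gcongr
      _ = _ := by ring
  rw [div_mul_eq_mul_div, div_le_iff₀ (by positivity)]
  exact hs.trans (le_of_mul_le_mul_right h2 hs0)

theorem two_mul_le_of_mul_sq_le {E C N L l f lam : ℝ} (hf : 0 < f) (hl : 0 < l) (hE : 0 ≤ E)
    (hC : 0 ≤ C) (hN : 0 ≤ N) (hL : l / 4 ≤ L) (hNle : N ≤ 2 * (lam * f * l))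
    (h : E * L ^ 2 ≤ C * N ^ 2 / f) : 2 * E ≤ 128 * C * lam ^ 2 * f := by
  have h2 : E * (l / 4) ^ 2 ≤ 64 * C * lam ^ 2 * f * (l / 4) ^ 2 := by
    calc E * (l / 4) ^ 2 ≤ E * L ^ 2 := by gcongr
      _ ≤ C * N ^ 2 / f := h
      _ ≤ C * (2 * (lam * f * l)) ^ 2 / f := by gcongr
      _ = 64 * C * lam ^ 2 * f * (l / 4) ^ 2 := by field_simp; ring
  linarith [le_of_mul_le_mul_right h2 (by positivity)]

/-- For `X` of order at least `φ(q) log q`, the primes below `X` occupy a positive proportion of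
the reduced residue classes. -/
theorem eventually_le_ncard_reducedPrimeClasses {lam : ℝ} (hlam : 0 < lam) :
    ∃ c : ℝ, 0 < c ∧ ∀ᶠ q : ℕ in Filter.atTop, ∀ X : ℝ,
      lam * (Nat.totient q : ℝ) * Real.log (q : ℝ) ≤ X →
        c * (Nat.totient q : ℝ) ≤ ((reducedPrimeClasses q X).ncard : ℝ) := by
  obtain ⟨C, hC, hpairs⟩ := exists_sum_card_prime_pairs_le
  obtain ⟨N₀, hN₀⟩ := Filter.eventually_atTop.1 eventually_le_card_primes_mul_log
  -- Chebyshev with log N ≤ 2 log q yields (λ/4) φ(q) primes; half of that is reserved for the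
  -- primes dividing q.
  set c₂ := lam / 8 with hc₂
  have hc₂0 : 0 < c₂ := by positivity
  refine ⟨c₂ / (1 + 128 * C * lam ^ 2 / c₂), by positivity, ?_⟩
  have hcast := tendsto_natCast_atTop_atTop (R := ℝ)
  have hlog : Filter.Tendsto (fun q : ℕ => Real.log q) Filter.atTop Filter.atTop :=
    Real.tendsto_log_atTop.comp hcast
  have hsqrt : Filter.Tendsto (fun q : ℕ => √(q : ℝ)) Filter.atTop Filter.atTop :=
    Real.tendsto_sqrt_atTop.comp hcast
  have hlo₁ : ∀ᶠ q : ℕ in Filter.atTop, ‖Real.log q‖ ≤ 1 / (2 * lam) * ‖(q : ℝ)‖ :=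
    (Real.isLittleO_log_id_atTop.comp_tendsto hcast).bound (by positivity)
  have hlo₂ : ∀ᶠ q : ℕ in Filter.atTop, ‖Real.log q‖ ≤ c₂ / 4 * ‖(q : ℝ) ^ (1 / 2 : ℝ)‖ :=
    ((isLittleO_log_rpow_atTop (by norm_num : (0 : ℝ) < 1 / 2)).comp_tendsto hcast).bound
      (by positivity)
  -- In order, these give Y ≥ φ(q), N ≤ q², 2 log q ≤ c₂ φ(q), N ≥ N₀ and N ≥ q^(1/4); the last
  -- three also use φ(q) ≥ √q/2.
  filter_upwards [hlog.eventually_ge_atTop (1 / lam), hlo₁, hlo₂,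
    hsqrt.eventually_ge_atTop (2 * N₀ : ℝ), Filter.eventually_ge_atTop 16]
    with q hq₁ hq₂ hq₃ hq₄ hq₅ X hX
  have hq16 : (16 : ℝ) ≤ q := by exact_mod_cast hq₅
  have hq0 : q ≠ 0 := by omega
  set f : ℝ := (q.totient : ℝ) with hf
  set l : ℝ := Real.log q with hl
  have hl0 : 0 < l := Real.log_pos (by linarith)
  rw [Real.norm_of_nonneg hl0.le, Real.norm_of_nonneg (by positivity)] at hq₂ hq₃
  rw [← Real.sqrt_eq_rpow] at hq₃
  have hf1 : 1 ≤ f := by rw [hf]; exact_mod_cast Nat.totient_pos.2 (Nat.pos_of_ne_zero hq0)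
  have hfq : f ≤ q := by rw [hf]; exact_mod_cast Nat.totient_le q
  have hsf : √(q : ℝ) ≤ 2 * f := sqrt_le_two_mul_totient q
  have hlaml : 1 ≤ lam * l := by
    rw [div_le_iff₀ hlam] at hq₁
    linarith
  set Y : ℝ := lam * f * l with hY
  have hfY : f ≤ Y := by
    have : f * 1 ≤ f * (lam * l) := by gcongr
    linarith
  set N := ⌈Y⌉₊ with hN
  have hYN : Y ≤ N := Nat.le_ceil Y
  have hNY : (N : ℝ) ≤ 2 * Y := by
    have := (Nat.ceil_lt_add_one (by linarith : 0 ≤ Y)).le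
    linarith
  have hN1 : 1 ≤ N := by
    have : (1 : ℝ) ≤ N := by linarith
    exact_mod_cast this
  have hNN₀ : N₀ ≤ N := by
    have : (N₀ : ℝ) ≤ N := by linarith
    exact_mod_cast this
  have hNpos : (0 : ℝ) < N := by exact_mod_cast hN1
  have hlogN_ge : l / 4 ≤ Real.log N := by
    have h1 : √√(q : ℝ) ≤ N := by
      have h2 : 2 ≤ √√(q : ℝ) := by
        rw [Real.le_sqrt' (by norm_num), Real.le_sqrt' (by norm_num)]
        linarith
      have h3 := Real.mul_self_sqrt (Real.sqrt_nonneg (q : ℝ))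
      nlinarith
    have h2 := Real.log_le_log (by positivity) h1
    rw [Real.log_sqrt (by positivity), Real.log_sqrt (by positivity)] at h2
    linarith
  have hlogN_le : Real.log N ≤ 2 * l := by
    have h1 : (N : ℝ) ≤ (q : ℝ) ^ 2 := by
      have h2 : 2 * lam * l ≤ q := by
        calc 2 * lam * l ≤ 2 * lam * (1 / (2 * lam) * q) := by gcongr
          _ = q := by field_simp
      calc (N : ℝ) ≤ f * (2 * lam * l) := by linarith
        _ ≤ q * q := by gcongr
        _ = (q : ℝ) ^ 2 := by ring
    have h2 := Real.log_le_log hNpos h1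
    rw [Real.log_pow] at h2
    exact_mod_cast h2
  set S : Finset ℕ := {p ∈ range N | p.Prime ∧ p.Coprime q} with hS
  set E := ∑ k ∈ Icc 1 (N / q), #{n ∈ range N | n.Prime ∧ (n + k * q).Prime} with hE
  have hSlow : c₂ * f ≤ #S := by
    have h1 := hN₀ N hNN₀
    have h2 : lam / 4 * f ≤ #{p ∈ range N | p.Prime} := by
      have h3 : (#{p ∈ range N | p.Prime} : ℝ) * Real.log N ≤
          #{p ∈ range N | p.Prime} * (2 * l) := by gcongr
      have h4 : lam / 4 * f * (2 * l) ≤ #{p ∈ range N | p.Prime} * (2 * l) := by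
        linarith
      exact le_of_mul_le_mul_right h4 (by positivity)
    have h3 : (#{p ∈ range N | p.Prime} : ℝ) ≤ #S + #q.primeFactors := by
      exact_mod_cast card_primes_le_card_coprime_add hq0 N
    have h4 := card_primeFactors_le_two_mul_log hq0
    have h5 : 2 * l ≤ c₂ * f := by nlinarith
    have h6 : lam / 4 * f = 2 * (c₂ * f) := by rw [hc₂]; ring
    linarith
  have hEle : 2 * (E : ℝ) ≤ 128 * C * lam ^ 2 * f :=
    two_mul_le_of_mul_sq_le (by linarith) hl0 (Nat.cast_nonneg _) hC.le hNpos.le hlogN_ge hNY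
      (hpairs q (Nat.pos_of_ne_zero hq0) N hN1)
  refine div_mul_le_of_sq_le (by linarith) hc₂0 (by positivity) (by positivity) hSlow hEle ?_
  exact_mod_cast card_coprime_primes_sq_le (Nat.pos_of_ne_zero hq0) hX

theorem two_lt_of_primeClasses_nonempty {q : ℕ} {X : ℝ} (h : (primeClasses q X).Nonempty) :
    2 < X := by
  obtain ⟨_, p, hp, hpX, -⟩ := h
  have : (2 : ℝ) ≤ p := by exact_mod_cast hp.two_le
  linarith

theorem one_le_ncard_primeClasses (q : ℕ) {X : ℝ} (hX : 2 < X) :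
    1 ≤ (primeClasses q X).ncard :=
  (Set.ncard_pos (finite_primeClasses q X)).2 ⟨_, 2, Nat.prime_two, by exact_mod_cast hX, rfl⟩

/-- If the primes below `X` occupy at least `c φ(q)` residue classes, then `X` is at least of
order `φ(q) log q`. -/
theorem exists_mul_totient_mul_log_le {c : ℝ} (hc : 0 < c) : ∃ c' : ℝ, 0 < c' ∧
    ∀ q : ℕ, 1 ≤ q → ∀ X : ℝ, c * (Nat.totient q : ℝ) ≤ ((primeClasses q X).ncard : ℝ) →
      c' * (Nat.totient q : ℝ) * Real.log (q : ℝ) ≤ X := by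
  -- c/48 serves N ≥ q^(1/4), where log N ≥ (log q)/4. Otherwise q is bounded in terms of c, and the
  -- second constant brings the left side down to 2 < X.
  refine ⟨min (c / 48) (2 * (c / 4) ^ 8), by positivity, fun q hq X h => ?_⟩
  have hq1 : (1 : ℝ) ≤ q := by exact_mod_cast hq
  set f : ℝ := (q.totient : ℝ) with hf
  set l : ℝ := Real.log q with hl
  have hl0 : 0 ≤ l := Real.log_nonneg hq1
  have hf1 : 1 ≤ f := by rw [hf]; exact_mod_cast Nat.totient_pos.2 hq
  have hfq : f ≤ q := by rw [hf]; exact_mod_cast Nat.totient_le q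
  have hlq : l ≤ q := (Real.log_le_sub_one_of_pos (by linarith)).trans (by linarith)
  have hX2 : 2 < X := by
    refine two_lt_of_primeClasses_nonempty (q := q) ?_
    refine (Set.ncard_pos (finite_primeClasses q X)).1 ?_
    have : (0 : ℝ) < (primeClasses q X).ncard := lt_of_lt_of_le (by positivity) h
    exact_mod_cast this
  set N := ⌈X⌉₊ with hN
  have hXN : X ≤ N := Nat.le_ceil X
  have hN2 : 2 ≤ N := by
    have : (2 : ℝ) ≤ N := by linarith
    exact_mod_cast this
  have hNX : (N : ℝ) ≤ 2 * X := by
    have := (Nat.ceil_lt_add_one (by linarith : 0 ≤ X)).le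
    linarith
  have hcard : c * f ≤ #{p ∈ range N | p.Prime} :=
    h.trans (by exact_mod_cast ncard_primeClasses_le q X)
  have hlogN : 0 ≤ Real.log N := Real.log_natCast_nonneg N
  by_cases hcase : √√(q : ℝ) ≤ N
  · have h1 := Real.log_le_log (by positivity) hcase
    rw [Real.log_sqrt (by positivity), Real.log_sqrt (by positivity)] at h1
    have h2 : c * f * (l / 4) ≤ 12 * X := by
      calc c * f * (l / 4) ≤ #{p ∈ range N | p.Prime} * Real.log N := by
            gcongr
            linarith
        _ ≤ 6 * N := card_primes_mul_log_le hN2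
        _ ≤ 12 * X := by linarith
    calc min (c / 48) (2 * (c / 4) ^ 8) * f * l ≤ c / 48 * f * l := by
          gcongr
          exact min_le_left _ _
      _ ≤ X := by linarith
  · have h1 : (#{p ∈ range N | p.Prime} : ℝ) ≤ N := by
      exact_mod_cast (card_filter_le _ _).trans (card_range N).le
    have hsf : √(q : ℝ) ≤ 2 * f := sqrt_le_two_mul_totient q
    set t := √√(q : ℝ) with ht
    have ht0 : 0 < t := by positivity
    have ht2 : t * t = √(q : ℝ) := Real.mul_self_sqrt (Real.sqrt_nonneg _)
    have htq : t ^ 4 = q := by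
      have := Real.mul_self_sqrt (by positivity : (0 : ℝ) ≤ q)
      rw [← ht2] at this
      linarith
    -- Here (c/2) t² ≤ c φ(q) ≤ N < t, since t² = √q ≤ 2 φ(q).
    have h2 : c / 2 * t ≤ 1 := by
      have h3 : c / 2 * t * t ≤ 1 * t := by nlinarith
      exact le_of_mul_le_mul_right h3 ht0
    have h3 : (c / 4) ^ 8 * (q * q) ≤ 1 := by
      rw [← htq]
      calc (c / 4) ^ 8 * (t ^ 4 * t ^ 4) = (c / 4 * t) ^ 8 := by ring
        _ ≤ 1 := pow_le_one₀ (by positivity) (by nlinarith)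
    calc min (c / 48) (2 * (c / 4) ^ 8) * f * l ≤ 2 * (c / 4) ^ 8 * q * q := by
          gcongr
          exact min_le_right _ _
      _ ≤ X := by linarith

end ResidueClasses

/-! ### Assembly of the two statements. -/

theorem theorem1p2 :
    (∀ lam : ℝ, 0 < lam → ∃ c : ℝ, 0 < c ∧
      (∃ q₀ : ℕ, ∀ q : ℕ, q₀ ≤ q → ∀ X : ℝ,
        lam * (Nat.totient q : ℝ) * Real.log (q : ℝ) ≤ X →
          c * (Nat.totient q : ℝ) ≤ ((reducedPrimeClasses q X).ncard : ℝ)) ∧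
      (∀ q : ℕ, 1 ≤ q → ∀ X : ℝ, 2 < X →
        lam * (Nat.totient q : ℝ) * Real.log (q : ℝ) ≤ X →
          c * (Nat.totient q : ℝ) ≤ ((primeClasses q X).ncard : ℝ))) ∧
    (∀ c : ℝ, 0 < c → ∃ c' : ℝ, 0 < c' ∧
      ∀ q : ℕ, 1 ≤ q → ∀ X : ℝ,
        c * (Nat.totient q : ℝ) ≤ ((primeClasses q X).ncard : ℝ) →
          c' * (Nat.totient q : ℝ) * Real.log (q : ℝ) ≤ X) := by
  refine ⟨fun lam hlam => ?_, fun c hc => exists_mul_totient_mul_log_le hc⟩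
  obtain ⟨c, hc, h⟩ := eventually_le_ncard_reducedPrimeClasses hlam
  obtain ⟨q₀, hq₀⟩ := Filter.eventually_atTop.1 h
  -- For q ≤ q₀ the class of 2 alone suffices, as φ(q) ≤ q₀ + 1. That class need not be reduced, so
  -- this covers only the unrestricted count.
  refine ⟨min c (1 / (q₀ + 1)), by positivity, ⟨q₀, fun q hq X hX => ?_⟩, fun q hq X hX2 hX => ?_⟩
  · refine le_trans ?_ (hq₀ q hq X hX)
    gcongr
    exact min_le_left _ _
  · rcases le_total q₀ q with hqq | hqq
    · calc min c (1 / ((q₀ : ℝ) + 1)) * (q.totient : ℝ) ≤ c * q.totient := by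
            gcongr
            exact min_le_left _ _
        _ ≤ ((reducedPrimeClasses q X).ncard : ℝ) := hq₀ q hqq X hX
        _ ≤ ((primeClasses q X).ncard : ℝ) := by
            exact_mod_cast Set.ncard_le_ncard (reducedPrimeClasses_subset q X)
              (finite_primeClasses q X)
    · have h1 : (1 : ℝ) ≤ (primeClasses q X).ncard := by
        exact_mod_cast one_le_ncard_primeClasses q hX2
      have h2 : (q.totient : ℝ) ≤ q₀ + 1 := by
        exact_mod_cast (Nat.totient_le q).trans (hqq.trans (Nat.le_succ q₀))
      calc min c (1 / ((q₀ : ℝ) + 1)) * (q.totient : ℝ) ≤ 1 / ((q₀ : ℝ) + 1) * (q₀ + 1) := by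
            gcongr
            exact min_le_right _ _
        _ = 1 := by field_simp
        _ ≤ _ := h1
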